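/- **Definitions.** Let $V$ be a finite set of items. A *bidder* is a triple $u=(\alpha,\beta,z)$ with an integer ID $\alpha$, a bid $\beta$ (a partial function from $V$ to $\mathbb R$) and a priority $z\in\mathbb R$; $\mathrm{items}(u)$ is the domain of $\beta$ and $w(u,v)=\beta(v)$ for $v\in\mathrm{items}(u)$. A *UAP* $A=(U,V)$ is a finite set $U$ of bidders with distinct IDs, viewed as a bipartite graph with an edge $(u,v)$ of weight $w(u,v)$ for $u\in U$, $v\in\mathrm{items}(u)$. An MWM is a maximum-weight matching of this graph. A set of bidders is *independent* if some MWM matches all of them. An MWM is *greedy* if the set of bidders that it matches has maximum total priority among the (inclusion-)maximal independent sets. If the ID of $u$ is not used in $A$, then $A+u=(U\cup\{u\},V)$. For a UAP $A$ and $v\in V$, $\mathrm{threshold}(A,v)$ is the unique pair $(x^*,z^*)\in\mathbb R\times(\mathbb R\cup\{-\infty\})$ such that for every bidder $u$ with bid $\{(v,x)\}$ and priority $z$ whose ID is not used in $A$: if $(x,z)>(x^*,z^*)$ then $u$ is matched in every greedy MWM of $A+u$; if $(x,z)<(x^*,z^*)$ then $u$ is matched in no greedy MWM of $A+u$; if $(x,z)=(x^*,z^*)$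 then $u$ is matched in some but not all greedy MWMs of $A+u$. All comparisons of pairs are lexicographic. A *multibidder* is a pair $t=(\sigma,z)$, where $\sigma$ is a finite sequence of bidders with distinct IDs and common priority $z$. An *IUAP* $B=(T,V)$ is a finite set $T$ of multibidders with distinct priorities such that bidders of distinct multibidders have distinct IDs. The UAP $\mathrm{uap}(B)$ is the output of the following nondeterministic algorithm, which does not depend on the choices made: start with $A=(\emptyset,V)$; while there is a multibidder $t=(\sigma,z)\in T$ with a bidder not yet in $A$ such that no greedy MWM of $A$ matches a bidder of priority $z$, choose such a $t$ and add to $A$ the first bidder of $\sigma$ not yet in $A$; return $A$. For a bidder $u$ whose ID is not used in $B$, $B+u$ is obtained from $B$ by appending $u$ to the sequence of the multibidder that has the priority of $u$, or, if there is none, by adding the multibidder whose sequence consists of $u$ alone. A *winner* of $B$ is a bidder matched in every greedy MWM of $\mathrm{uap}(B)$. For $v\in V$, $\mathrm{uap}(B,v)$ is the unique UAP $(U,V)$ with $U$ contained in the set of bidders of $B$ such that $\mathrm{uap}(B+u)=(U\cup\{u\},V)$ for every $u$, with ID not used in $B$ and bid of the form $\{(v,x)\}$, that is a winner of $B+u$;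 and $\mathrm{threshold}(B,v)=\mathrm{threshold}(\mathrm{uap}(B,v),v)$. **Lemma.** Let $B=(T,V)$ be an IUAP, let $t=(\sigma,z)\in T$, and let $B'$ denote the IUAP $(T\setminus\{t\},V)$. Suppose that for some $k$ the bidder $\sigma(k)$ is matched to the item $v$ in some greedy MWM of $\mathrm{uap}(B)$. Then $\mathrm{uap}(B)$ is indeed the only possible output of the algorithm on input $B$, for every item $v'$ the objects $\mathrm{uap}(B',v')$ and $\mathrm{threshold}(B',v')$ are well defined (they exist and are unique), $$(w(\sigma(k),v),z)\ \ge\ \mathrm{threshold}(B',v),$$ and for every $k'$ with $1\le k'<k$ and every $v'\in\mathrm{items}(\sigma(k'))$, $$(w(\sigma(k'),v'),z)\ <\ \mathrm{threshold}(B',v').$$ -/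

import Mathlib

/-!
Unit-demand auctions with priorities (UAPs) and iterated unit-demand auctions with priorities
(IUAPs).  Throughout, the set of items is the type `ι`, which the theorem takes to be finite.
-/

/-- A bidder `(α, β, z)`: an integer ID, a unit-demand bid (a partial function from items to
reals), and a real priority. -/
@[ext]
structure Bidder (ι : Type*) where
  id : ℤ
  bid : ι → Option ℝ
  priority : ℝ

noncomputable instance Bidder.instDecidableEq {ι : Type*} : DecidableEq (Bidder ι) :=
  Classical.decEq _

/-- `items(u)`: the items on which `u` bids. -/
def Bidder.items {ι : Type*} (u : Bidder ι) : Set ι := {v | ∃ x, u.bid v = some x}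

/-- `w(u, v)`: the amount that `u` bids on `v` (only meaningful if `v ∈ items(u)`). -/
noncomputable def Bidder.weight {ι : Type*} (u : Bidder ι) (v : ι) : ℝ := (u.bid v).getD 0

/-- The bid of `u` is `{(v, x)}`. -/
def Bidder.BidsOnly {ι : Type*} (u : Bidder ι) (v : ι) (x : ℝ) : Prop :=
  ∀ v' x', u.bid v' = some x' ↔ v' = v ∧ x' = x

/-! ### Unit-demand auctions with priorities -/

/-- A UAP: a finite set of bidders with distinct IDs. -/
@[ext]
structure UAP (ι : Type*) where
  bidders : Finset (Bidder ι)
  id_ne : ∀ u ∈ bidders, ∀ u' ∈ bidders, u ≠ u' → u.id ≠ u'.id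

namespace UAP

variable {ι : Type*}

/-- The UAP without bidders. -/
def empty : UAP ι := ⟨∅, by simp⟩

instance : Nonempty (UAP ι) := ⟨empty⟩

/-- The ID of `u` differs from the ID of every bidder of `A`. -/
def Fresh (A : UAP ι) (u : Bidder ι) : Prop := ∀ u' ∈ A.bidders, u'.id ≠ u.id

/-- The UAP `A + u`. -/
noncomputable def add (A : UAP ι) (u : Bidder ι) (hu : A.Fresh u) : UAP ι where
  bidders := insert u A.bidders
  id_ne := by
    intro a ha b hb hab
    rcases Finset.mem_insert.1 ha with rfl | ha' <;> rcases Finset.mem_insert.1 hb with rfl | hb'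
    · exact absurd rfl hab
    · exact (hu b hb').symm
    · exact hu a ha'
    · exact A.id_ne a ha' b hb' hab

/-- A matching of the associated bipartite graph, as a set of edges. -/
def IsMatching (A : UAP ι) (M : Finset (Bidder ι × ι)) : Prop :=
  (∀ e ∈ M, e.1 ∈ A.bidders ∧ e.2 ∈ e.1.items) ∧
    ∀ e ∈ M, ∀ f ∈ M, e.1 = f.1 ∨ e.2 = f.2 → e = f

/-- `w(M)`. -/
noncomputable def matchingWeight (M : Finset (Bidder ι × ι)) : ℝ := ∑ e ∈ M, e.1.weight e.2

/-- `M` is a maximum-weight matching (MWM) of `A`. -/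
def IsMWM (A : UAP ι) (M : Finset (Bidder ι × ι)) : Prop :=
  A.IsMatching M ∧ ∀ M', A.IsMatching M' → matchingWeight M' ≤ matchingWeight M

/-- `matched(M)`: the set of bidders matched in `M`. -/
noncomputable def matched (M : Finset (Bidder ι × ι)) : Finset (Bidder ι) := M.image Prod.fst

/-- The independent sets of `matroid(A)`: sets of bidders all of which are matched by a common
MWM of `A`. -/
def Indep (A : UAP ι) (S : Finset (Bidder ι)) : Prop :=
  S ⊆ A.bidders ∧ ∃ M, A.IsMWM M ∧ S ⊆ matched M

/-- The priority of a set of bidders. -/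
noncomputable def setPriority (S : Finset (Bidder ι)) : ℝ := ∑ u ∈ S, u.priority

/-- `M` is a greedy MWM of `A`: an MWM such that `matched(M)` is a maximum-priority maximal
independent set of `matroid(A)`. -/
def IsGreedyMWM (A : UAP ι) (M : Finset (Bidder ι × ι)) : Prop :=
  A.IsMWM M ∧ Maximal A.Indep (matched M) ∧
    ∀ S, Maximal A.Indep S → setPriority S ≤ setPriority (matched M)

/-- `greedy(A, z) = 0`: no bidder of priority `z` is matched in a greedy MWM of `A`. -/
def GreedyZero (A : UAP ι) (z : ℝ) : Prop :=
  ∀ M, A.IsGreedyMWM M → ∀ u ∈ matched M, u.priority ≠ z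

/-- The defining property of the threshold `p` of item `v` in `A`: for every bidder `u` such that
`A + u` is a UAP and the bid of `u` is `{(v, x)}`, the lexicographic comparison of
`(x, priority(u))` with `p` decides whether `u` is matched in all, none, or some but not all of the
greedy MWMs of `A + u`.  The second component of `p` is `⊥` (minus infinity) if, at the
critical offer, `u` is matched whatever its priority is; for example, this is so for the threshold
`(0, ⊥)` of an item on which no bidder of `A` bids. -/
def IsThreshold (A : UAP ι) (v : ι) (p : ℝ ×ₗ WithBot ℝ) : Prop :=
  ∀ (u : Bidder ι) (hu : A.Fresh u) (x : ℝ), u.BidsOnly v x →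
    (p < toLex (x, (u.priority : WithBot ℝ)) →
      ∀ M, (A.add u hu).IsGreedyMWM M → u ∈ matched M) ∧
    (toLex (x, (u.priority : WithBot ℝ)) < p →
      ∀ M, (A.add u hu).IsGreedyMWM M → u ∉ matched M) ∧
    (toLex (x, (u.priority : WithBot ℝ)) = p →
      (∃ M, (A.add u hu).IsGreedyMWM M ∧ u ∈ matched M) ∧
        ∃ M, (A.add u hu).IsGreedyMWM M ∧ u ∉ matched M)

/-- `threshold(A, v)`: the pair with the defining property. -/
noncomputable def threshold (A : UAP ι) (v : ι) : ℝ ×ₗ WithBot ℝ :=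
  @Classical.epsilon _ ⟨toLex (0, ⊥)⟩ (A.IsThreshold v)

end UAP

/-! ### Iterated unit-demand auctions with priorities -/

/-- A multibidder `(σ, z)`: a sequence of bidders with distinct IDs and common priority `z`. -/
@[ext]
structure Multibidder (ι : Type*) where
  seq : List (Bidder ι)
  priority : ℝ
  nodup_id : (seq.map Bidder.id).Nodup
  priority_eq : ∀ u ∈ seq, u.priority = priority

noncomputable instance Multibidder.instDecidableEq {ι : Type*} : DecidableEq (Multibidder ι) :=
  Classical.decEq _

namespace Multibidder

variable {ι : Type*}

/-- `bidders(t)`. -/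
noncomputable def bidders (t : Multibidder ι) : Finset (Bidder ι) := t.seq.toFinset

/-- The multibidder `(⟨u⟩, priority(u))`. -/
def single (u : Bidder ι) : Multibidder ι := ⟨[u], u.priority, by simp, by simp⟩

/-- The multibidder obtained from `t` by appending `u` to its sequence of bidders. -/
def append (t : Multibidder ι) (u : Bidder ι) (hz : t.priority = u.priority)
    (hu : ∀ w ∈ t.bidders, w.id ≠ u.id) : Multibidder ι where
  seq := t.seq ++ [u]
  priority := t.priority
  nodup_id := by
    rw [List.map_append, List.nodup_append]
    refine ⟨t.nodup_id, by simp, ?_⟩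
    intro a ha b hb
    obtain ⟨w, hw, rfl⟩ := List.mem_map.1 ha
    have hb' : b = u.id := by simpa using hb
    rw [hb']
    exact hu w (List.mem_toFinset.2 hw)
  priority_eq := by
    intro w hw
    rcases List.mem_append.1 hw with h | h
    · exact t.priority_eq w h
    · rw [List.mem_singleton.1 h, hz]

end Multibidder

/-- An IUAP: a finite set of multibidders with distinct priorities such that bidders of distinct
multibidders have distinct IDs. -/
@[ext]
structure IUAP (ι : Type*) where
  multibidders : Finset (Multibidder ι)
  priority_ne : ∀ t ∈ multibidders, ∀ t' ∈ multibidders, t ≠ t' → t.priority ≠ t'.priority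
  id_ne : ∀ t ∈ multibidders, ∀ t' ∈ multibidders, t ≠ t' →
    ∀ u ∈ t.bidders, ∀ u' ∈ t'.bidders, u.id ≠ u'.id

namespace IUAP

variable {ι : Type*}

/-- `bidders(B)`. -/
noncomputable def bidders (B : IUAP ι) : Finset (Bidder ι) :=
  B.multibidders.biUnion Multibidder.bidders

/-- The IUAP `(T - t, V)`, where `B = (T, V)`. -/
noncomputable def erase (B : IUAP ι) (t : Multibidder ι) : IUAP ι where
  multibidders := B.multibidders.erase t
  priority_ne := fun a ha b hb =>
    B.priority_ne a (Finset.mem_of_mem_erase ha) b (Finset.mem_of_mem_erase hb)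
  id_ne := fun a ha b hb =>
    B.id_ne a (Finset.mem_of_mem_erase ha) b (Finset.mem_of_mem_erase hb)

/-- The ID of `u` differs from the ID of every bidder of `B`; this is the condition for `B + u` to
be an IUAP. -/
def Fresh (B : IUAP ι) (u : Bidder ι) : Prop := ∀ w ∈ B.bidders, w.id ≠ u.id

theorem Fresh.of_mem {B : IUAP ι} {u : Bidder ι} (hu : B.Fresh u) {t : Multibidder ι}
    (ht : t ∈ B.multibidders) : ∀ w ∈ t.bidders, w.id ≠ u.id :=
  fun w hw => hu w (Finset.mem_biUnion.2 ⟨t, ht, hw⟩)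

/-- The IUAP obtained by inserting a multibidder. -/
noncomputable def insert (B : IUAP ι) (t : Multibidder ι)
    (hp : ∀ t' ∈ B.multibidders, t'.priority ≠ t.priority)
    (hid : ∀ t' ∈ B.multibidders, ∀ w ∈ t'.bidders, ∀ u ∈ t.bidders, w.id ≠ u.id) : IUAP ι where
  multibidders := Insert.insert t B.multibidders
  priority_ne := by
    intro a ha b hb hab
    rcases Finset.mem_insert.1 ha with rfl | ha' <;> rcases Finset.mem_insert.1 hb with rfl | hb'
    · exact absurd rfl hab
    · exact (hp b hb').symm
    · exact hp a ha'
    · exact B.priority_ne a ha' b hb' hab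
  id_ne := by
    intro a ha b hb hab u hu w hw
    rcases Finset.mem_insert.1 ha with rfl | ha' <;> rcases Finset.mem_insert.1 hb with rfl | hb'
    · exact absurd rfl hab
    · exact (hid b hb' w hw u hu).symm
    · exact hid a ha' u hu w hw
    · exact B.id_ne a ha' b hb' hab u hu w hw

open Classical in
/-- The IUAP `B + u`: if `B` has a multibidder `t` with the priority of `u`, then `u` is appended to
the sequence of `t`; otherwise a new multibidder `(⟨u⟩, priority(u))` is added. -/
noncomputable def add (B : IUAP ι) (u : Bidder ι) (hu : B.Fresh u) : IUAP ι :=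
  if h : ∃ t ∈ B.multibidders, t.priority = u.priority then
    (B.erase h.choose).insert
      (h.choose.append u h.choose_spec.2 (hu.of_mem h.choose_spec.1))
      (fun t' ht' => B.priority_ne t' (Finset.mem_of_mem_erase ht') h.choose h.choose_spec.1
        (Finset.ne_of_mem_erase (s := B.multibidders) ht'))
      (by
        intro t' ht' w hw u' hu'
        have hB := Finset.mem_of_mem_erase ht'
        rcases List.mem_append.1 (List.mem_toFinset.1 hu') with h1 | h1
        · exact B.id_ne t' hB h.choose h.choose_spec.1
            (Finset.ne_of_mem_erase (s := B.multibidders) ht') w hw u'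
            (List.mem_toFinset.2 h1)
        · rw [List.mem_singleton.1 h1]
          exact hu.of_mem hB w hw)
  else
    B.insert (Multibidder.single u) (fun t' ht' e => h ⟨t', ht', e⟩)
      (by
        intro t' ht' w hw u' hu'
        rw [List.mem_singleton.1 (List.mem_toFinset.1 hu')]
        exact hu.of_mem ht' w hw)

/-! ### The algorithm `ToUap` -/

/-- `u ∈ ready(C)` for the configuration `C = (A, B)`: no bidder with the priority of `u` is matched
in a greedy MWM of `A`, and `u` is the next unrevealed bidder of its multibidder `t`.  (Sequences are
indexed from `0`, and the set of revealed bidders of `t` is `A.bidders ∩ t.bidders`.) -/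
def IsReady (B : IUAP ι) (A : UAP ι) (u : Bidder ι) : Prop :=
  A.GreedyZero u.priority ∧
    ∃ t ∈ B.multibidders, t.seq[(A.bidders ∩ t.bidders).card]? = some u

/-- One iteration of the loop of `ToUap`: some ready bidder is revealed. -/
def Step (B : IUAP ι) (A A' : UAP ι) : Prop :=
  ∃ (u : Bidder ι) (hu : A.Fresh u), B.IsReady A u ∧ A' = A.add u hu

/-- Some execution of the nondeterministic algorithm `ToUap` on input `B` returns `A`. -/
def Returns (B : IUAP ι) (A : UAP ι) : Prop :=
  Relation.ReflTransGen B.Step UAP.empty A ∧ ∀ u, ¬ B.IsReady A u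

/-- `prefix(A, B)`. -/
def Prefix (A : UAP ι) (B : IUAP ι) : Prop :=
  A.bidders ⊆ B.bidders ∧
    ∀ t ∈ B.multibidders, ∃ i, A.bidders ∩ t.bidders = (t.seq.take i).toFinset

theorem eq_of_id_eq (B : IUAP ι) {u w : Bidder ι} (hu : u ∈ B.bidders) (hw : w ∈ B.bidders)
    (h : u.id = w.id) : u = w := by
  obtain ⟨t, ht, hut⟩ := Finset.mem_biUnion.1 hu
  obtain ⟨s, hs, hws⟩ := Finset.mem_biUnion.1 hw
  by_cases hts : t = s
  · subst hts
    exact List.inj_on_of_nodup_map t.nodup_id (List.mem_toFinset.1 hut) (List.mem_toFinset.1 hws) h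
  · exact absurd h (B.id_ne t ht s hs hts u hut w hws)

theorem Prefix.ready {A : UAP ι} {B : IUAP ι} (h : Prefix A B) {u : Bidder ι}
    (hu : B.IsReady A u) :
    u ∈ B.bidders ∧ ∃ hf : A.Fresh u, Prefix (A.add u hf) B := by
  obtain ⟨-, t, ht, hget⟩ := hu
  obtain ⟨i, hi⟩ := h.2 t ht
  have hnd : t.seq.Nodup := List.Nodup.of_map _ t.nodup_id
  have hcard : (A.bidders ∩ t.bidders).card = min i t.seq.length := by
    rw [hi, List.toFinset_card_of_nodup (hnd.sublist (List.take_sublist _ _)), List.length_take]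
  rw [hcard] at hget
  obtain ⟨hlt, hget'⟩ := List.getElem?_eq_some_iff.1 hget
  have hil : i < t.seq.length := by omega
  have hmin : min i t.seq.length = i := by omega
  rw [hmin] at hget
  have hut : u ∈ t.bidders := List.mem_toFinset.2 (List.mem_of_getElem? hget)
  have huB : u ∈ B.bidders := Finset.mem_biUnion.2 ⟨t, ht, hut⟩
  have htake : t.seq.take (i + 1) = t.seq.take i ++ [u] := by
    rw [List.take_add_one, hget]; rfl
  have huA : u ∉ A.bidders := by
    intro hc
    have h1 : u ∈ t.seq.take i := by
      rw [← List.mem_toFinset, ← hi]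
      exact Finset.mem_inter.2 ⟨hc, hut⟩
    have h2 : (t.seq.take (i + 1)).Nodup := hnd.sublist (List.take_sublist _ _)
    rw [htake, List.nodup_append] at h2
    exact h2.2.2 u h1 u (by simp) rfl
  have hf : A.Fresh u := by
    intro w hw e
    exact huA (B.eq_of_id_eq (h.1 hw) huB e ▸ hw)
  refine ⟨huB, hf, ?_, ?_⟩
  · intro w hw
    rcases Finset.mem_insert.1 hw with rfl | hw'
    · exact huB
    · exact h.1 hw'
  · intro s hs
    by_cases hst : s = t
    · subst hst
      refine ⟨i + 1, ?_⟩
      change Insert.insert u A.bidders ∩ s.bidders = _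
      rw [htake, Finset.insert_inter_of_mem hut, hi]
      ext w
      simp
    · obtain ⟨j, hj⟩ := h.2 s hs
      refine ⟨j, ?_⟩
      have hus : u ∉ s.bidders := fun hc => B.id_ne s hs t ht hst u hc u hut rfl
      change Insert.insert u A.bidders ∩ s.bidders = _
      rw [Finset.insert_inter_of_notMem hus, hj]

/-- `ToUap` terminates. -/
theorem exists_returns (B : IUAP ι) : ∃ A, B.Returns A := by
  have key : ∀ (n : ℕ) (A : UAP ι), Prefix A B → Relation.ReflTransGen B.Step UAP.empty A →
      B.bidders.card - A.bidders.card = n → ∃ A', B.Returns A' := by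
    intro n
    induction n using Nat.strong_induction_on with
    | _ n ih =>
      intro A hP hR hn
      by_cases hr : ∃ u, B.IsReady A u
      · obtain ⟨u, hu⟩ := hr
        obtain ⟨huB, hf, hP'⟩ := hP.ready hu
        have hc : (A.add u hf).bidders.card = A.bidders.card + 1 :=
          Finset.card_insert_of_notMem fun hc => hf u hc rfl
        have hle := Finset.card_le_card hP'.1
        exact ih _ (by omega) (A.add u hf) hP' (hR.tail ⟨u, hf, hu, rfl⟩) rfl
      · exact ⟨A, hR, fun u hu => hr ⟨u, hu⟩⟩
  refine key _ UAP.empty ⟨by simp [UAP.empty], fun t _ => ⟨0, by simp [UAP.empty]⟩⟩ .refl rfl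

/-- `uap(B)`: the UAP returned by the executions of `ToUap` on input `B`. -/
noncomputable def uap (B : IUAP ι) : UAP ι := B.exists_returns.choose

/-- `u ∈ winners(B)`: `u` is matched in every greedy MWM of `uap(B)`. -/
def IsWinner (B : IUAP ι) (u : Bidder ι) : Prop :=
  ∀ M, B.uap.IsGreedyMWM M → u ∈ UAP.matched M

/-! ### Threshold of an item -/

/-- The defining property of `uap(B, v)`, a UAP whose bidders are bidders of `B`: whenever `B + u` is
an IUAP in which `u` bids on `v` only and is a winner, `uap(B + u)` is obtained from it by
adding `u`. -/
def IsUapAt (B : IUAP ι) (v : ι) (A : UAP ι) : Prop :=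
  A.bidders ⊆ B.bidders ∧
    ∀ (u : Bidder ι) (hu : B.Fresh u) (x : ℝ), u.BidsOnly v x → (B.add u hu).IsWinner u →
      (B.add u hu).uap.bidders = Insert.insert u A.bidders

/-- `uap(B, v)`: the UAP with the defining property. -/
noncomputable def uapAt (B : IUAP ι) (v : ι) : UAP ι := Classical.epsilon (B.IsUapAt v)

/-- `threshold(B, v)`. -/
noncomputable def threshold (B : IUAP ι) (v : ι) : ℝ ×ₗ WithBot ℝ := (B.uapAt v).threshold v

end IUAP

/-! Weight, cardinality and total priority of a matching combine into one additive weight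
`lexWeight` with values in a lexicographically ordered group, and the greedy MWMs are exactly the
matchings that maximize it (`isGreedyMWM_iff`). Swapping an alternating path between two matchings
preserves the multiset union of their edges, so two optima whose swapped versions are feasible yield
two optima. Hence a matchable bidder stays matchable when other bidders leave or items arrive
(`CanMatch.mono`), all optima of a market match the same priorities (`Opt.exists_priority_eq`), and
optima do not shrink when bidders join (`Opt.card_le`).

By the monotonicity of `CanMatch`, stuck sets are closed under intersection. Every execution returns
the least one, so uap(B) is unique; likewise uap(B', v) is the least stuck set S of the other
multibidders in the market without v (`LeastStuck.eq_insert`). The threshold of v encodes how much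
the optimal `lexWeight` gains from v, and an offer is at or above it iff a bidder u making only this
offer can be matched after joining (`threshold_le_iff`). Both inequalities thus ask whether the
restriction u of a bidder of t to one item is matchable in S + u.

For σ(k), a greedy MWM of uap(B) matches no other bidder of priority z, so the revealed bidders of
other priorities form a stuck set U of the market without v. Then S ⊆ U, u can replace σ(k) in an
optimum of U + u, and monotonicity passes from U + u to S + u (`LeastStuck.canMatch_of_matched`).

For an earlier σ(k'), cutting σ after σ(k') gives an outcome A₁ in which no bidder of priority z is
matchable. If u were matchable in S + u, an optimum for the least stuck set C of the other bidders
and u would match u besides every priority matched in A₁, so it would be larger than an optimum N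
for A₁. But N is also optimal for a superset of C, so it cannot be smaller
(`LeastStuck.not_canMatch_of_lt`). -/

set_option linter.unusedSectionVars false

/-! ### Exchanges between two matchings -/

namespace Matching

variable {α β : Type*} [DecidableEq α] [DecidableEq β]

/-- No two distinct edges of `M` share an endpoint. -/
def Disjointed (M : Finset (α × β)) : Prop := ∀ e ∈ M, ∀ f ∈ M, e.1 = f.1 ∨ e.2 = f.2 → e = f

/-- The set of left endpoints. -/
def lefts (M : Finset (α × β)) : Finset α := M.image Prod.fst

/-- The set of right endpoints. -/
def rights (M : Finset (α × β)) : Finset β := M.image Prod.snd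

theorem mem_lefts {M : Finset (α × β)} {a : α} : a ∈ lefts M ↔ ∃ b, (a, b) ∈ M := by
  simp [lefts]

theorem mem_rights {M : Finset (α × β)} {b : β} : b ∈ rights M ↔ ∃ a, (a, b) ∈ M := by
  simp [rights]

theorem Disjointed.mono {M N : Finset (α × β)} (hM : Disjointed M) (h : N ⊆ M) : Disjointed N :=
  fun e he f hf => hM e (h he) f (h hf)

theorem Disjointed.insert {M : Finset (α × β)} (hM : Disjointed M) {a : α} {b : β}
    (ha : a ∉ lefts M) (hb : b ∉ rights M) : Disjointed (insert (a, b) M) := by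
  rw [mem_lefts] at ha
  rw [mem_rights] at hb
  push Not at ha hb
  rintro ⟨c, d⟩ he ⟨c', d'⟩ hf h
  rcases Finset.mem_insert.1 he with he' | he' <;> rcases Finset.mem_insert.1 hf with hf' | hf'
  · rw [he', hf']
  · obtain ⟨rfl, rfl⟩ := Prod.mk.inj he'
    rcases h with h | h <;> simp only at h <;> subst h
    · exact absurd hf' (ha _)
    · exact absurd hf' (hb _)
  · obtain ⟨rfl, rfl⟩ := Prod.mk.inj hf'
    rcases h with h | h <;> simp only at h <;> subst h
    · exact absurd he' (ha _)
    · exact absurd he' (hb _)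
  · exact hM _ he' _ hf' h

theorem Disjointed.lefts_erase {M : Finset (α × β)} (hM : Disjointed M) {a : α} {b : β}
    (h : (a, b) ∈ M) : lefts (M.erase (a, b)) = (lefts M).erase a := by
  ext c
  simp only [mem_lefts, Finset.mem_erase]
  constructor
  · rintro ⟨d, hd, hd'⟩
    refine ⟨?_, d, hd'⟩
    rintro rfl
    exact hd (hM _ hd' _ h (Or.inl rfl))
  · rintro ⟨hc, d, hd⟩
    exact ⟨d, fun e => hc (Prod.mk.inj e).1, hd⟩

theorem Disjointed.rights_erase {M : Finset (α × β)} (hM : Disjointed M) {a : α} {b : β}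
    (h : (a, b) ∈ M) : rights (M.erase (a, b)) = (rights M).erase b := by
  ext c
  simp only [mem_rights, Finset.mem_erase]
  constructor
  · rintro ⟨d, hd, hd'⟩
    refine ⟨?_, d, hd'⟩
    rintro rfl
    exact hd (hM _ hd' _ h (Or.inr rfl))
  · rintro ⟨hc, d, hd⟩
    exact ⟨d, fun e => hc (Prod.mk.inj e).2, hd⟩

theorem lefts_insert (M : Finset (α × β)) (a : α) (b : β) :
    lefts (insert (a, b) M) = insert a (lefts M) := by
  simp [lefts, Finset.image_insert]

theorem rights_insert (M : Finset (α × β)) (a : α) (b : β) :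
    rights (insert (a, b) M) = insert b (rights M) := by
  simp [rights, Finset.image_insert]

theorem notMem_of_notMem_lefts {M : Finset (α × β)} {a : α} (h : a ∉ lefts M) (b : β) :
    (a, b) ∉ M := fun hc => h (mem_lefts.2 ⟨b, hc⟩)

theorem notMem_of_notMem_rights {M : Finset (α × β)} {b : β} (h : b ∉ rights M) (a : α) :
    (a, b) ∉ M := fun hc => h (mem_rights.2 ⟨a, hc⟩)

theorem cons_val_erase {M : Finset (α × β)} {e : α × β} (h : e ∈ M) :
    e ::ₘ (M.erase e).val = M.val := by
  rw [Finset.erase_val, Multiset.cons_erase h]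

theorem Disjointed.card_lefts {M : Finset (α × β)} (hM : Disjointed M) :
    (lefts M).card = M.card :=
  Finset.card_image_of_injOn fun e he f hf h => hM e he f hf (Or.inl h)

/-- The alternating path from `a` moves `a` from `M` to `N`, and either moves along the right
endpoint `b` or moves back the left endpoint `a'`. -/
def Exchange (M N M₁ M₂ : Finset (α × β)) (a : α) : Prop :=
  (∃ b ∈ rights M, b ∉ rights N ∧ lefts M₁ = (lefts M).erase a ∧ lefts M₂ = insert a (lefts N) ∧
      rights M₁ = (rights M).erase b ∧ rights M₂ = insert b (rights N)) ∨
    ∃ a' ∈ lefts N, a' ∉ lefts M ∧ lefts M₁ = insert a' ((lefts M).erase a) ∧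
      lefts M₂ = insert a ((lefts N).erase a') ∧ rights M₁ = rights M ∧ rights M₂ = rights N

/-- Swap the edges of the alternating path that starts with the `M`-edge at `a`. It ends at a right
vertex that `N` misses or at a left vertex that `M` misses, which are the two cases of `Exchange`.
Every further round uses up an edge of `N`. -/
theorem exists_exchange {M N : Finset (α × β)} (hM : Disjointed M) (hN : Disjointed N) {a : α}
    (haM : a ∈ lefts M) (haN : a ∉ lefts N) :
    ∃ M₁ M₂, Disjointed M₁ ∧ Disjointed M₂ ∧ M₁.val + M₂.val = M.val + N.val ∧
      Exchange M N M₁ M₂ a := by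
  induction hn : N.card generalizing M N a with
  | zero =>
    obtain rfl := Finset.card_eq_zero.1 hn
    obtain ⟨b, hb⟩ := mem_lefts.1 haM
    have hbN : b ∉ rights (∅ : Finset (α × β)) := by simp [rights]
    refine ⟨M.erase (a, b), insert (a, b) ∅, hM.mono (Finset.erase_subset _ _),
      hN.insert haN hbN, ?_, Or.inl ⟨b, mem_rights.2 ⟨a, hb⟩, hbN, hM.lefts_erase hb,
        lefts_insert _ _ _, hM.rights_erase hb, rights_insert _ _ _⟩⟩
    rw [← cons_val_erase hb, Finset.insert_val_of_notMem (notMem_of_notMem_lefts haN b)]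
    simp only [Finset.empty_val, Multiset.add_zero, Multiset.cons_zero]
    rw [add_comm, Multiset.singleton_add]
  | succ n ih =>
    obtain ⟨b, hb⟩ := mem_lefts.1 haM
    by_cases hbN : b ∈ rights N
    swap
    · refine ⟨M.erase (a, b), insert (a, b) N, hM.mono (Finset.erase_subset _ _),
        hN.insert haN hbN, ?_, Or.inl ⟨b, mem_rights.2 ⟨a, hb⟩, hbN, hM.lefts_erase hb,
          lefts_insert _ _ _, hM.rights_erase hb, rights_insert _ _ _⟩⟩
      rw [← cons_val_erase hb, Finset.insert_val_of_notMem (notMem_of_notMem_lefts haN b)]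
      simp
    obtain ⟨c, hc⟩ := mem_rights.1 hbN
    have hcN : c ∈ lefts N := mem_lefts.2 ⟨b, hc⟩
    have hac : a ≠ c := fun h => haN (h ▸ hcN)
    have hM0 := hM.mono (Finset.erase_subset (a, b) M)
    have hN0 := hN.mono (Finset.erase_subset (c, b) N)
    have hbM0 : b ∉ rights (M.erase (a, b)) := by simp [hM.rights_erase hb]
    have hbN0 : b ∉ rights (N.erase (c, b)) := by simp [hN.rights_erase hc]
    have hbM : b ∈ rights M := mem_rights.2 ⟨a, hb⟩
    by_cases hcM : c ∈ lefts M
    swap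
    · have h1 : c ∉ lefts (M.erase (a, b)) := by simp [hM.lefts_erase hb, hcM]
      have h2 : a ∉ lefts (N.erase (c, b)) := by simp [hN.lefts_erase hc, haN]
      refine ⟨insert (c, b) (M.erase (a, b)), insert (a, b) (N.erase (c, b)), hM0.insert h1 hbM0,
        hN0.insert h2 hbN0, ?_, Or.inr ⟨c, hcN, hcM, ?_, ?_, ?_, ?_⟩⟩
      · rw [Finset.insert_val_of_notMem (notMem_of_notMem_lefts h1 b),
          Finset.insert_val_of_notMem (notMem_of_notMem_lefts h2 b), ← cons_val_erase hb,
          ← cons_val_erase hc]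
        simp only [Multiset.cons_add, Multiset.add_cons, Finset.erase_val]
        exact Multiset.cons_swap _ _ _
      · rw [lefts_insert, hM.lefts_erase hb]
      · rw [lefts_insert, hN.lefts_erase hc]
      · rw [rights_insert, hM.rights_erase hb, Finset.insert_erase hbM]
      · rw [rights_insert, hN.rights_erase hc, Finset.insert_erase hbN]
    -- The path continues: drop both edges at `b` and recurse from `c`, now free in the rest of `N`.
    have hcM0 : c ∈ lefts (M.erase (a, b)) := by
      rw [hM.lefts_erase hb]; exact Finset.mem_erase.2 ⟨hac.symm, hcM⟩
    have hcN0 : c ∉ lefts (N.erase (c, b)) := by simp [hN.lefts_erase hc]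
    obtain ⟨M₁, M₂, h1, h2, hval, hex⟩ := ih hM0 hN0 hcM0 hcN0
      (by rw [Finset.card_erase_of_mem hc, hn]; rfl)
    have haM0 : a ∉ lefts (M.erase (a, b)) := by simp [hM.lefts_erase hb]
    have haN0 : a ∉ lefts (N.erase (c, b)) := by simp [hN.lefts_erase hc, haN]
    -- The recursive swap leaves these endpoints free, so the two dropped edges can return with
    -- their sides exchanged.
    have key : c ∉ lefts M₁ ∧ b ∉ rights M₁ ∧ a ∉ lefts M₂ ∧ b ∉ rights M₂ := by
      rcases hex with ⟨d, hd, hdN, e1, e2, e3, e4⟩ | ⟨d, hd, hdN, e1, e2, e3, e4⟩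
      · rw [e1, e2, e3, e4]
        refine ⟨by simp, fun h => hbM0 (Finset.mem_of_mem_erase h), ?_, ?_⟩
        · simp [hac, haN0]
        · simp only [Finset.mem_insert, not_or]
          exact ⟨fun h => hbM0 (h ▸ hd), hbN0⟩
      · rw [e1, e2, e3, e4]
        refine ⟨?_, hbM0, ?_, hbN0⟩
        · simp only [Finset.mem_insert, not_or]
          exact ⟨fun h => hdN (h ▸ hcM0), by simp⟩
        · simp only [Finset.mem_insert, not_or]
          exact ⟨hac, fun h => haN0 (Finset.mem_of_mem_erase h)⟩
    obtain ⟨k1, k2, k3, k4⟩ := key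
    refine ⟨insert (c, b) M₁, insert (a, b) M₂, h1.insert k1 k2, h2.insert k3 k4, ?_, ?_⟩
    · rw [Finset.insert_val_of_notMem (notMem_of_notMem_lefts k1 b),
        Finset.insert_val_of_notMem (notMem_of_notMem_lefts k3 b), ← cons_val_erase hb,
        ← cons_val_erase hc]
      rw [Multiset.cons_add, Multiset.add_cons, hval, Multiset.cons_add, Multiset.add_cons]
      exact Multiset.cons_swap _ _ _
    · simp only [Exchange, lefts_insert, rights_insert]
      rw [Exchange] at hex
      rw [hM.lefts_erase hb] at hex hcM0
      rw [hN.lefts_erase hc] at hex haN0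
      rw [hM.rights_erase hb, hN.rights_erase hc] at hex
      rcases hex with ⟨d, hd, hdN, e1, e2, e3, e4⟩ | ⟨d, hd, hdN, e1, e2, e3, e4⟩
      · left
        have hdb : d ≠ b := Finset.ne_of_mem_erase hd
        refine ⟨d, Finset.mem_of_mem_erase hd,
          fun h => hdN (Finset.mem_erase.2 ⟨hdb, h⟩), ?_, ?_, ?_, ?_⟩
        · rw [e1, Finset.insert_erase hcM0]
        · rw [e2, Finset.insert_erase hcN]
        · rw [e3, Finset.erase_right_comm, Finset.insert_erase]
          exact Finset.mem_erase.2 ⟨hdb.symm, hbM⟩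
        · rw [e4, Finset.insert_comm, Finset.insert_erase hbN]
      · right
        have hda : d ≠ a := fun h => haN0 (h ▸ hd)
        have hdc : d ≠ c := Finset.ne_of_mem_erase hd
        refine ⟨d, Finset.mem_of_mem_erase hd,
          fun h => hdN (Finset.mem_erase.2 ⟨hda, h⟩), ?_, ?_, ?_, ?_⟩
        · rw [e1, Finset.insert_comm, Finset.insert_erase hcM0]
        · rw [e2, Finset.erase_right_comm, Finset.insert_erase]
          exact Finset.mem_erase.2 ⟨hdc.symm, hcN⟩
        · rw [e3, Finset.insert_erase hbM]
        · rw [e4, Finset.insert_erase hbN]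

/-- What the two types of exchange have in common. -/
theorem Exchange.subset {M N M₁ M₂ : Finset (α × β)} {a : α} (h : Exchange M N M₁ M₂ a) :
    a ∈ lefts M₂ ∧ lefts M₂ ⊆ insert a (lefts N) ∧ lefts M₁ ⊆ lefts M ∪ lefts N ∧
      rights M₁ ⊆ rights M ∧ rights M₂ ⊆ rights M ∪ rights N := by
  rcases h with ⟨b, hb, hbN, e1, e2, e3, e4⟩ | ⟨c, hc, hcM, e1, e2, e3, e4⟩
  · rw [e1, e2, e3, e4]
    refine ⟨by simp, subset_rfl, ?_, Finset.erase_subset _ _, ?_⟩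
    · exact (Finset.erase_subset _ _).trans Finset.subset_union_left
    · exact Finset.insert_subset (Finset.mem_union_left _ hb) Finset.subset_union_right
  · rw [e1, e2, e3, e4]
    refine ⟨by simp, Finset.insert_subset_insert _ (Finset.erase_subset _ _), ?_, subset_rfl,
      Finset.subset_union_right⟩
    exact Finset.insert_subset (Finset.mem_union_right _ hc)
      ((Finset.erase_subset _ _).trans Finset.subset_union_left)

theorem Exchange.notMem {M N M₁ M₂ : Finset (α × β)} {a : α} (h : Exchange M N M₁ M₂ a)
    (ha : a ∉ lefts N) : a ∉ lefts M₁ := by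
  rcases h with ⟨b, hb, hbN, e1, e2, e3, e4⟩ | ⟨c, hc, hcM, e1, e2, e3, e4⟩
  · simp [e1]
  · rw [e1]
    simp only [Finset.mem_insert, not_or]
    exact ⟨fun h => ha (h ▸ hc), by simp⟩

end Matching

/-! ### Optimal matchings -/

namespace UnitDemand

open Matching

variable {ι : Type*} [DecidableEq ι]

/-- Greedy MWMs maximize weight, then cardinality, then priority; this is the corresponding weight
of an edge. -/
noncomputable def edgeWeight (e : Bidder ι × ι) : ℝ ×ₗ ℝ ×ₗ ℝ :=
  toLex (e.1.weight e.2, toLex (1, e.1.priority))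

/-- The sum of the edge weights of `M`. -/
noncomputable def lexWeight (M : Finset (Bidder ι × ι)) : ℝ ×ₗ ℝ ×ₗ ℝ := ∑ e ∈ M, edgeWeight e

/-- `M` is a matching between bidders in `S` and items in `P`. -/
def Feasible (S : Finset (Bidder ι)) (P : Set ι) (M : Finset (Bidder ι × ι)) : Prop :=
  (∀ e ∈ M, e.1 ∈ S ∧ e.2 ∈ P ∧ e.2 ∈ e.1.items) ∧ Disjointed M

/-- `M` has maximum `lexWeight` among the matchings between `S` and `P`. -/
def Opt (S : Finset (Bidder ι)) (P : Set ι) (M : Finset (Bidder ι × ι)) : Prop :=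
  Feasible S P M ∧ ∀ M', Feasible S P M' → lexWeight M' ≤ lexWeight M

/-- Some optimal matching matches `w`. -/
def CanMatch (S : Finset (Bidder ι)) (P : Set ι) (w : Bidder ι) : Prop :=
  ∃ M, Opt S P M ∧ w ∈ lefts M

variable {S S' : Finset (Bidder ι)} {P P' : Set ι} {M N : Finset (Bidder ι × ι)} {u w : Bidder ι}

theorem lexWeight_eq (M : Finset (Bidder ι × ι)) :
    lexWeight M = toLex (UAP.matchingWeight M, toLex ((M.card : ℝ), ∑ e ∈ M, e.1.priority)) := by
  induction M using Finset.induction_on with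
  | empty => simp [lexWeight, UAP.matchingWeight]; rfl
  | insert e M he ih =>
    rw [lexWeight, Finset.sum_insert he, ← lexWeight, ih, UAP.matchingWeight, UAP.matchingWeight,
      Finset.sum_insert he, Finset.sum_insert he, Finset.card_insert_of_notMem he, edgeWeight]
    push_cast
    rw [add_comm (M.card : ℝ)]
    rfl

theorem lexWeight_insert {e : Bidder ι × ι} (he : e ∉ M) :
    lexWeight (insert e M) = edgeWeight e + lexWeight M := Finset.sum_insert he

theorem lexWeight_erase {e : Bidder ι × ι} (he : e ∈ M) :
    edgeWeight e + lexWeight (M.erase e) = lexWeight M := Finset.add_sum_erase _ _ he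

theorem Feasible.mem (h : Feasible S P M) (hw : w ∈ lefts M) : w ∈ S := by
  obtain ⟨b, hb⟩ := mem_lefts.1 hw
  exact (h.1 _ hb).1

theorem CanMatch.mem (h : CanMatch S P w) : w ∈ S := by
  obtain ⟨M, hM, hw⟩ := h
  exact hM.1.mem hw

theorem Feasible.mono (h : Feasible S P M) (hS : S ⊆ S') (hP : P ⊆ P') : Feasible S' P' M :=
  ⟨fun e he => ⟨hS (h.1 e he).1, hP (h.1 e he).2.1, (h.1 e he).2.2⟩, h.2⟩

theorem Feasible.subset (h : Feasible S P M) (hN : N ⊆ M) : Feasible S P N :=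
  ⟨fun e he => h.1 e (hN he), h.2.mono hN⟩

theorem Feasible.restrict (h : Feasible S P M) (hS : lefts M ⊆ S') : Feasible S' P M :=
  ⟨fun e he => ⟨hS (mem_lefts.2 ⟨e.2, he⟩), (h.1 e he).2⟩, h.2⟩

theorem Feasible.of_insert (h : Feasible (insert u S) P M) (hu : u ∉ lefts M) : Feasible S P M :=
  h.restrict fun _ hw => (Finset.mem_insert.1 (h.mem hw)).resolve_left fun e => hu (e ▸ hw)

theorem Feasible.insert_edge {v : ι} (h : Feasible S P M) (hu : u ∈ S) (huM : u ∉ lefts M) (hv : v ∈ P)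
    (hvM : v ∉ rights M) (hi : v ∈ u.items) : Feasible S P (insert (u, v) M) := by
  refine ⟨fun e he => ?_, h.2.insert huM hvM⟩
  rcases Finset.mem_insert.1 he with rfl | he
  · exact ⟨hu, hv, hi⟩
  · exact h.1 e he

theorem Feasible.notMem_rights {v : ι} (h : Feasible S {v}ᶜ M) : v ∉ rights M := by
  intro hv
  obtain ⟨a, ha⟩ := mem_rights.1 hv
  exact (h.1 _ ha).2.1 rfl

theorem Feasible.compl {v : ι} (h : Feasible S Set.univ M) (hv : v ∉ rights M) :
    Feasible S {v}ᶜ M :=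
  ⟨fun e he => ⟨(h.1 e he).1, fun hc => hv (mem_rights.2 ⟨e.1, hc ▸ he⟩), (h.1 e he).2.2⟩, h.2⟩

/-- Removing the edge that covers `v` leaves a matching that avoids `v`. -/
theorem Feasible.erase {v : ι} (h : Feasible S Set.univ M) (huv : (u, v) ∈ M) :
    Feasible (S.erase u) {v}ᶜ (M.erase (u, v)) := by
  have h1 := (h.subset (Finset.erase_subset (u, v) M)).compl (v := v)
    (by simp [h.2.rights_erase huv])
  refine h1.restrict ?_
  rw [h.2.lefts_erase huv]
  exact fun w hw => Finset.mem_erase.2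
    ⟨Finset.ne_of_mem_erase hw, h.mem (Finset.mem_of_mem_erase hw)⟩

theorem exists_opt [Finite ι] (S : Finset (Bidder ι)) (P : Set ι) : ∃ M, Opt S P M := by
  classical
  have := Fintype.ofFinite ι
  let F := (S ×ˢ (Finset.univ : Finset ι)).powerset.filter (Feasible S P)
  have hF : F.Nonempty := ⟨∅, Finset.mem_filter.2 ⟨by simp, by simp, by simp [Disjointed]⟩⟩
  obtain ⟨M, hM, hmax⟩ := F.exists_max_image lexWeight hF
  refine ⟨M, (Finset.mem_filter.1 hM).2, fun M' hM' => hmax M' (Finset.mem_filter.2 ⟨?_, hM'⟩)⟩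
  exact Finset.mem_powerset.2 fun e he => Finset.mem_product.2 ⟨(hM'.1 e he).1, Finset.mem_univ _⟩

theorem Opt.of_le (hM : Opt S P M) (hN : Feasible S P N) (h : lexWeight M ≤ lexWeight N) :
    Opt S P N := ⟨hN, fun M' hM' => (hM.2 M' hM').trans h⟩

theorem Opt.lexWeight_eq (hM : Opt S P M) (hN : Opt S P N) : lexWeight M = lexWeight N :=
  le_antisymm (hN.2 M hM.1) (hM.2 N hN.1)

/-- Optimality passes to smaller sets of bidders that still contain the matched ones. -/
theorem Opt.restrict (hM : Opt S P M) (hS : S' ⊆ S) (h : lefts M ⊆ S') : Opt S' P M :=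
  ⟨hM.1.restrict h, fun M' hM' => hM.2 M' (hM'.mono hS subset_rfl)⟩

theorem card_eq_of_lexWeight_eq (h : lexWeight M = lexWeight N) : M.card = N.card := by
  rw [UnitDemand.lexWeight_eq, UnitDemand.lexWeight_eq] at h
  have h2 := (Prod.mk.inj (toLex.injective h)).2
  exact_mod_cast (Prod.mk.inj (toLex.injective h2)).1

theorem Opt.card_eq (hM : Opt S P M) (hN : Opt S P N) : M.card = N.card :=
  card_eq_of_lexWeight_eq (hM.lexWeight_eq hN)

theorem sum_priority_lefts (hM : Disjointed M) :
    ∑ w ∈ lefts M, w.priority = ∑ e ∈ M, e.1.priority :=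
  Finset.sum_image fun e he f hf h => hM e he f hf (Or.inl h)

theorem Opt.sum_priority_eq (hM : Opt S P M) (hN : Opt S P N) :
    ∑ w ∈ lefts M, w.priority = ∑ w ∈ lefts N, w.priority := by
  rw [sum_priority_lefts hM.1.2, sum_priority_lefts hN.1.2]
  have h := hM.lexWeight_eq hN
  rw [UnitDemand.lexWeight_eq, UnitDemand.lexWeight_eq] at h
  have h2 := (Prod.mk.inj (toLex.injective h)).2
  exact (Prod.mk.inj (toLex.injective h2)).2

/-! ### Exchanges between optimal matchings of two markets -/

theorem sum_eq_of_val_add_eq {G : Type*} [AddCommMonoid G] {κ : Type*} {M N M₁ M₂ : Finset κ}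
    (f : κ → G) (h : M₁.val + M₂.val = M.val + N.val) :
    ∑ e ∈ M₁, f e + ∑ e ∈ M₂, f e = ∑ e ∈ M, f e + ∑ e ∈ N, f e := by
  simp only [Finset.sum, ← Multiset.sum_add, ← Multiset.map_add, h]

/-- A bidder `a` matched in the market with more bidders and fewer items can be exchanged into a
matching of the market with fewer bidders and more items. -/
theorem Feasible.exchange (hM : Feasible S' P' M) (hN : Feasible S P N) (hS : S ⊆ S')
    (hP : P' ⊆ P) {a : Bidder ι} (haS : a ∈ S) (haM : a ∈ lefts M) (haN : a ∉ lefts N) :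
    ∃ M₁ M₂, Feasible S' P' M₁ ∧ Feasible S P M₂ ∧ M₁.val + M₂.val = M.val + N.val ∧
      Exchange M N M₁ M₂ a := by
  obtain ⟨M₁, M₂, h1, h2, hval, hex⟩ := exists_exchange hM.2 hN.2 haM haN
  obtain ⟨-, k2, k3, k4, k5⟩ := hex.subset
  have hitems : ∀ e ∈ M₁.val + M₂.val, e.2 ∈ e.1.items := by
    intro e he
    rw [hval] at he
    rcases Multiset.mem_add.1 he with he | he
    · exact (hM.1 e he).2.2
    · exact (hN.1 e he).2.2
  have hPM : ∀ b ∈ rights M, b ∈ P' := fun b hb => by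
    obtain ⟨a, ha⟩ := mem_rights.1 hb
    exact (hM.1 _ ha).2.1
  have hPN : ∀ b ∈ rights N, b ∈ P := fun b hb => by
    obtain ⟨a, ha⟩ := mem_rights.1 hb
    exact (hN.1 _ ha).2.1
  refine ⟨M₁, M₂, ⟨fun e he => ⟨?_, ?_, hitems e (Multiset.mem_add.2 (Or.inl he))⟩, h1⟩,
    ⟨fun e he => ⟨?_, ?_, hitems e (Multiset.mem_add.2 (Or.inr he))⟩, h2⟩, hval, hex⟩
  · rcases Finset.mem_union.1 (k3 (mem_lefts.2 ⟨e.2, he⟩)) with h | h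
    · exact hM.mem h
    · exact hS (hN.mem h)
  · exact hPM _ (k4 (mem_rights.2 ⟨e.1, he⟩))
  · rcases Finset.mem_insert.1 (k2 (mem_lefts.2 ⟨e.2, he⟩)) with h | h
    · exact h ▸ haS
    · exact hN.mem h
  · rcases Finset.mem_union.1 (k5 (mem_rights.2 ⟨e.1, he⟩)) with h | h
    · exact hP (hPM _ h)
    · exact hPN _ h

/-- The total equals the sum of the two maxima and neither term exceeds its own maximum, so both
maxima are attained. -/
theorem Opt.of_add (hM : Opt S' P' M) (hN : Opt S P N) {M₁ M₂ : Finset (Bidder ι × ι)}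
    (h1 : Feasible S' P' M₁) (h2 : Feasible S P M₂)
    (h : M₁.val + M₂.val = M.val + N.val) : Opt S' P' M₁ ∧ Opt S P M₂ := by
  have h := sum_eq_of_val_add_eq edgeWeight h
  rw [← lexWeight, ← lexWeight, ← lexWeight, ← lexWeight] at h
  have l1 := hM.2 _ h1
  have l2 := hN.2 _ h2
  refine ⟨hM.of_le h1 ?_, hN.of_le h2 ?_⟩
  · by_contra hc
    exact (add_lt_add_of_lt_of_le (not_le.1 hc) l2).ne h
  · by_contra hc
    exact (add_lt_add_of_le_of_lt l1 (not_le.1 hc)).ne h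

/-- Fewer rivals and more items never hurt. Exchanging at `w` adds only `w` to the bidders used in
the small set `S`, and no item to those used in the small set `P'`, so both results stay feasible
and hence optimal. -/
theorem CanMatch.mono [Finite ι] (h : CanMatch S' P' w) (hw : w ∈ S) (hS : S ⊆ S') (hP : P' ⊆ P) :
    CanMatch S P w := by
  obtain ⟨M, hM, hwM⟩ := h
  obtain ⟨N, hN⟩ := exists_opt S P
  by_cases hwN : w ∈ lefts N
  · exact ⟨N, hN, hwN⟩
  obtain ⟨M₁, M₂, h1, h2, hval, hex⟩ := hM.1.exchange hN.1 hS hP hw hwM hwN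
  exact ⟨M₂, (hM.of_add hN h1 h2 hval).2, hex.subset.1⟩

/-- All optimal matchings match bidders of the same priorities. -/
theorem Opt.exists_priority_eq (hM : Opt S P M) (hN : Opt S P N) (hw : w ∈ lefts M) :
    ∃ w' ∈ lefts N, w'.priority = w.priority := by
  by_cases hwN : w ∈ lefts N
  · exact ⟨w, hwN, rfl⟩
  obtain ⟨M₁, M₂, h1, h2, hval, hex⟩ :=
    hM.1.exchange hN.1 subset_rfl subset_rfl (hM.1.mem hw) hw hwN
  have h2' := (hM.of_add hN h1 h2 hval).2
  rcases hex with ⟨b, hb, hbN, e1, e2, e3, e4⟩ | ⟨c, hc, hcM, e1, e2, e3, e4⟩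
  · have := hN.card_eq h2'
    rw [← hN.1.2.card_lefts, ← h2.2.card_lefts, e2, Finset.card_insert_of_notMem hwN] at this
    omega
  · refine ⟨c, hc, ?_⟩
    have h3 := hN.sum_priority_eq h2'
    rw [e2, Finset.sum_insert fun h => hwN (Finset.mem_of_mem_erase h),
      ← Finset.add_sum_erase _ _ hc] at h3
    linarith

/-- Exchanging at a matched `u` turns `N` into an optimum of the market without `u`; the path
deletes `u` or replaces it by another bidder, so no edge is gained. -/
theorem Opt.card_le_insert [Finite ι] (hM : Opt S P M) (hN : Opt (insert u S) P N) :
    M.card ≤ N.card := by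
  by_cases huN : u ∈ lefts N
  swap
  · exact (hM.card_eq (hN.restrict (Finset.subset_insert _ _)
      fun w hw => (Finset.mem_insert.1 (hN.1.mem hw)).resolve_left fun e => huN (e ▸ hw))).le
  by_cases hu : u ∈ S
  · rw [Finset.insert_eq_of_mem hu] at hN
    exact (hM.card_eq hN).le
  have huM : u ∉ lefts M := fun h => hu (hM.1.mem h)
  obtain ⟨M₁, M₂, h1, h2, hval, hex⟩ := hN.1.exchange
    (hM.1.mono (Finset.subset_insert u S) subset_rfl) subset_rfl subset_rfl
    (Finset.mem_insert_self u S) huN huM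
  have hval' : M₂.val + M₁.val = N.val + M.val := by rw [add_comm, hval]
  have h1' := (hN.of_add hM h2 (h1.of_insert (hex.notMem huM)) hval').2
  rw [hM.card_eq h1', ← h1.2.card_lefts, ← hN.1.2.card_lefts]
  rcases hex with ⟨b, hb, hbN, e1, e2, e3, e4⟩ | ⟨c, hc, hcM, e1, e2, e3, e4⟩
  · rw [e1]
    exact Finset.card_erase_le
  · rw [e1, Finset.card_insert_of_notMem fun h => hcM (Finset.mem_of_mem_erase h),
      Finset.card_erase_of_mem huN]
    have := Finset.card_pos.2 ⟨u, huN⟩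
    omega

/-- Adding bidders does not decrease the cardinality of optimal matchings. -/
theorem Opt.card_le [Finite ι] (hM : Opt S P M) (hN : Opt S' P N) (hS : S ⊆ S') :
    M.card ≤ N.card := by
  induction hn : (S' \ S).card generalizing S M with
  | zero =>
    have : S' = S := (Finset.sdiff_eq_empty_iff_subset.1 (Finset.card_eq_zero.1 hn)).antisymm hS
    subst this
    exact (hM.card_eq hN).le
  | succ n ih =>
    obtain ⟨u, hu⟩ := Finset.card_pos.1 (by omega : 0 < (S' \ S).card)
    obtain ⟨hu', huS⟩ := Finset.mem_sdiff.1 hu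
    obtain ⟨N', hN'⟩ := exists_opt (insert u S) P
    refine (hM.card_le_insert hN').trans (ih hN' (Finset.insert_subset hu' hS) ?_)
    rw [Finset.sdiff_insert, Finset.card_erase_of_mem hu, hn]
    rfl

/-! ### Greedy MWMs are the optimal matchings -/

theorem feasible_univ_iff {A : UAP ι} : Feasible A.bidders Set.univ M ↔ A.IsMatching M := by
  simp [Feasible, UAP.IsMatching, Disjointed]

theorem matched_eq_lefts : UAP.matched M = lefts M := by
  ext
  simp [UAP.matched, lefts]

theorem matchingWeight_add {M₁ M₂ : Finset (Bidder ι × ι)}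
    (h : M₁.val + M₂.val = M.val + N.val) :
    UAP.matchingWeight M₁ + UAP.matchingWeight M₂ = UAP.matchingWeight M + UAP.matchingWeight N :=
  sum_eq_of_val_add_eq _ h

/-- A maximal independent set has the maximum size of a matched set of an MWM. -/
theorem card_le_of_maximal_indep {A : UAP ι} (hM : A.IsMWM M) (hN : A.IsMWM N)
    (hmax : Maximal A.Indep (lefts N)) : M.card ≤ N.card := by
  induction hn : (lefts M \ lefts N).card generalizing M with
  | zero =>
    have hs := Finset.sdiff_eq_empty_iff_subset.1 (Finset.card_eq_zero.1 hn)
    rw [← Disjointed.card_lefts (feasible_univ_iff.2 hM.1).2,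
      ← Disjointed.card_lefts (feasible_univ_iff.2 hN.1).2]
    exact Finset.card_le_card hs
  | succ n ih =>
    obtain ⟨a, ha⟩ := Finset.card_pos.1 (by omega : 0 < (lefts M \ lefts N).card)
    obtain ⟨haM, haN⟩ := Finset.mem_sdiff.1 ha
    have fM := feasible_univ_iff.2 hM.1
    have fN := feasible_univ_iff.2 hN.1
    obtain ⟨M₁, M₂, h1, h2, hval, hex⟩ :=
      fM.exchange fN subset_rfl subset_rfl (fM.mem haM) haM haN
    have hw := matchingWeight_add hval
    have w1 := hM.2 _ (feasible_univ_iff.1 h1)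
    have w2 := hN.2 _ (feasible_univ_iff.1 h2)
    have hM1 : A.IsMWM M₁ :=
      ⟨feasible_univ_iff.1 h1, fun M' hM' => (hM.2 M' hM').trans (by linarith)⟩
    have hM2 : A.IsMWM M₂ :=
      ⟨feasible_univ_iff.1 h2, fun M' hM' => (hN.2 M' hM').trans (by linarith)⟩
    rcases hex with ⟨b, hb, hbN, e1, e2, e3, e4⟩ | ⟨c, hc, hcM, e1, e2, e3, e4⟩
    -- `M₂` would match `a` on top of `lefts N`, against maximality.
    · have hi : A.Indep (lefts M₂) :=
        ⟨fun w hw => h2.mem hw, M₂, hM2, by rw [matched_eq_lefts]⟩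
      refine absurd (hmax.2 hi ?_ ?_) haN
      · rw [e2]
        exact Finset.subset_insert _ _
      · rw [e2]
        exact Finset.mem_insert_self _ _
    -- `M₁` has the size of `M` and one bidder fewer outside `lefts N`.
    · have hca : c ∉ (lefts M).erase a := fun h => hcM (Finset.mem_of_mem_erase h)
      have hcard : M₁.card = M.card := by
        rw [← h1.2.card_lefts, ← fM.2.card_lefts, e1, Finset.card_insert_of_notMem hca,
          Finset.card_erase_of_mem haM]
        have := Finset.card_pos.2 ⟨a, haM⟩
        omega
      rw [← hcard]
      refine ih hM1 ?_
      rw [e1, Finset.insert_sdiff_of_mem _ hc, Finset.erase_sdiff_comm,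
        Finset.card_erase_of_mem ha, hn]
      rfl

/-- An optimum has the largest size among the MWMs, so its matched set is maximal independent. By
`card_le_of_maximal_indep` all maximal independent sets have this size, so only the priority entry
of `lexWeight` separates them. Conversely, a greedy MWM is at least as good as an optimum in every
entry. -/
theorem isGreedyMWM_iff [Finite ι] {A : UAP ι} :
    A.IsGreedyMWM M ↔ Opt A.bidders Set.univ M := by
  have lex : ∀ M N : Finset (Bidder ι × ι), lexWeight M ≤ lexWeight N ↔
      UAP.matchingWeight M < UAP.matchingWeight N ∨ UAP.matchingWeight M = UAP.matchingWeight N ∧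
        (M.card < N.card ∨ M.card = N.card ∧
          ∑ e ∈ M, e.1.priority ≤ ∑ e ∈ N, e.1.priority) := by
    intro M N
    rw [lexWeight_eq, lexWeight_eq, Prod.Lex.toLex_le_toLex, Prod.Lex.toLex_le_toLex]
    simp
  have prio : ∀ M, Feasible A.bidders Set.univ M →
      UAP.setPriority (lefts M) = ∑ e ∈ M, e.1.priority := fun M h => sum_priority_lefts h.2
  have main : ∀ N, Opt A.bidders Set.univ N → A.IsGreedyMWM N := by
    intro N hN
    have fN := feasible_univ_iff.1 hN.1
    have mN : A.IsMWM N := ⟨fN, fun M' hM' => by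
      rcases (lex _ _).1 (hN.2 M' (feasible_univ_iff.2 hM')) with h | h
      · exact h.le
      · exact h.1.le⟩
    have key : ∀ M', A.IsMWM M' → M'.card < N.card ∨ M'.card = N.card ∧
        ∑ e ∈ M', e.1.priority ≤ ∑ e ∈ N, e.1.priority := by
      intro M' hM'
      rcases (lex _ _).1 (hN.2 M' (feasible_univ_iff.2 hM'.1)) with h | h
      · exact absurd (hM'.2 N fN) (not_le.2 h)
      · exact h.2
    have indep : ∀ M', A.IsMWM M' → A.Indep (lefts M') := fun M' hM' =>
      ⟨fun w hw => (feasible_univ_iff.2 hM'.1).mem hw, M', hM', by rw [matched_eq_lefts]⟩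
    refine ⟨mN, ?_, ?_⟩
    · rw [matched_eq_lefts]
      refine ⟨indep N mN, ?_⟩
      rintro T ⟨-, M', hM', hT⟩ hNT
      rw [matched_eq_lefts] at hT
      have fM' := feasible_univ_iff.2 hM'.1
      have hc : (lefts M').card ≤ (lefts N).card := by
        rw [fM'.2.card_lefts, hN.1.2.card_lefts]
        rcases key M' hM' with h | h <;> omega
      have := Finset.eq_of_subset_of_card_le (hNT.trans hT) hc
      rw [this]
      exact hT
    · intro T hT
      obtain ⟨-, M', hM', hTM⟩ := hT.1
      rw [matched_eq_lefts] at hTM ⊢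
      have fM' := feasible_univ_iff.2 hM'.1
      have hTeq : T = lefts M' := hTM.antisymm (hT.2 (indep M' hM') hTM)
      rw [hTeq] at hT ⊢
      have hc := card_le_of_maximal_indep mN hM' hT
      rw [prio _ fM', prio _ hN.1]
      rcases key M' hM' with h | h
      · omega
      · exact h.2
  refine ⟨fun h => ?_, main M⟩
  obtain ⟨N, hN⟩ := exists_opt A.bidders (Set.univ : Set ι)
  have gN := main N hN
  have fM := feasible_univ_iff.2 h.1.1
  refine hN.of_le fM ((lex _ _).2 (Or.inr ⟨?_, ?_⟩))
  · exact le_antisymm (h.1.2 N gN.1.1) (gN.1.2 M h.1.1)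
  · have h2 := h.2.1
    have h3 := h.2.2 _ gN.2.1
    rw [matched_eq_lefts, matched_eq_lefts, prio _ fM, prio _ hN.1] at h3
    rw [matched_eq_lefts] at h2
    rcases (card_le_of_maximal_indep gN.1 h.1 h2).lt_or_eq with h | h
    · exact Or.inl h
    · exact Or.inr ⟨h, h3⟩

end UnitDemand

/-! ### Thresholds of UAPs -/

namespace UnitDemand

open Matching

variable {ι : Type*} [DecidableEq ι]

variable {S S' : Finset (Bidder ι)} {P P' : Set ι} {M N : Finset (Bidder ι × ι)} {u w : Bidder ι}
  {v : ι} {x : ℝ}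

theorem _root_.Bidder.BidsOnly.mem_items (hu : u.BidsOnly v x) : v ∈ u.items :=
  ⟨x, (hu v x).2 ⟨rfl, rfl⟩⟩

theorem _root_.Bidder.BidsOnly.weight_eq (hu : u.BidsOnly v x) : u.weight v = x := by
  simp [Bidder.weight, (hu v x).2 ⟨rfl, rfl⟩]

theorem _root_.Bidder.BidsOnly.eq_of_mem (hu : u.BidsOnly v x) {v' : ι} (h : v' ∈ u.items) :
    v' = v := by
  obtain ⟨y, hy⟩ := h
  exact ((hu v' y).1 hy).1

/-- There are bidders on a given item with given offer and priority and an unused ID. -/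
theorem exists_bidsOnly (T : Finset (Bidder ι)) (v : ι) (x z : ℝ) :
    ∃ u : Bidder ι, u.BidsOnly v x ∧ u.priority = z ∧ ∀ w ∈ T, w.id ≠ u.id := by
  obtain ⟨n, hn⟩ := (T.image Bidder.id).exists_notMem
  refine ⟨⟨n, fun i => if i = v then some x else none, z⟩, ?_, rfl, fun w hw e => hn ?_⟩
  · intro v' x'
    by_cases h : v' = v <;> simp [h, eq_comm]
  · exact Finset.mem_image.2 ⟨w, hw, e⟩

theorem edgeWeight_bidsOnly (hu : u.BidsOnly v x) :
    edgeWeight (u, v) = toLex (x, toLex (1, u.priority)) := by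
  rw [edgeWeight, hu.weight_eq]

theorem mem_of_bidsOnly (hu : u.BidsOnly v x) (hM : Feasible S P M) (h : u ∈ lefts M) :
    (u, v) ∈ M := by
  obtain ⟨b, hb⟩ := mem_lefts.1 h
  obtain rfl : b = v := hu.eq_of_mem (hM.1 _ hb).2.2
  exact hb

theorem Feasible.insert_bidsOnly (hN : Feasible S {v}ᶜ N) (hu : u.BidsOnly v x) (huS : u ∉ S) :
    Feasible (insert u S) Set.univ (insert (u, v) N) :=
  Feasible.insert_edge (hN.mono (Finset.subset_insert _ _) (Set.subset_univ _))
    (Finset.mem_insert_self _ _) (fun h => huS (hN.mem h)) (Set.mem_univ _) hN.notMem_rights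
    hu.mem_items

theorem lexWeight_insert_edge (hN : Feasible S {v}ᶜ N) :
    lexWeight (insert (u, v) N) = edgeWeight (u, v) + lexWeight N :=
  lexWeight_insert (notMem_of_notMem_rights hN.notMem_rights _)

/-- Without `v`, an optimal matching has the same size or is smaller by one. -/
theorem card_sub_of_opt [Finite ι] (hM : Opt S Set.univ M) (hN : Opt S {v}ᶜ N) :
    lexWeight M = lexWeight N ∨ M.card = N.card ∨ M.card = N.card + 1 := by
  by_cases hv : v ∈ rights M
  swap
  · left
    exact le_antisymm (hN.2 M (hM.1.compl hv)) (hM.2 N (hN.1.mono subset_rfl (Set.subset_univ _)))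
  right
  obtain ⟨a, ha⟩ := mem_rights.1 hv
  have haS : a ∈ S := (hM.1.1 _ ha).1
  have hai := (hM.1.1 _ ha).2.2
  have h0 := hM.1.erase ha
  have h0' := h0.mono (Finset.erase_subset a S) subset_rfl
  have ha0 : a ∉ lefts (M.erase (a, v)) := by simp [hM.1.2.lefts_erase ha]
  have hW := lexWeight_erase ha
  -- `K` resembles `N` but leaves `a` free. As `K'` is no better than `N`, `K` is no worse than `M`
  -- without its edge at `v`; so `K` with `(a, v)` is optimal and has the size of `M`.
  suffices h : ∃ K K', Feasible S {v}ᶜ K ∧ Feasible S {v}ᶜ K' ∧ a ∉ lefts K ∧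
      lexWeight K + lexWeight K' = lexWeight N + lexWeight (M.erase (a, v)) ∧
      (K.card = N.card ∨ K.card + 1 = N.card) by
    obtain ⟨K, K', h1, h2, haK, hval, hc⟩ := h
    have f := Feasible.insert_edge (h1.mono subset_rfl (Set.subset_univ _)) haS haK (Set.mem_univ v)
      h1.notMem_rights hai
    have e := lexWeight_insert_edge (u := a) h1
    have l1 := hM.2 _ f
    have l2 := hN.2 _ h2
    rw [e] at l1
    have l3 : lexWeight M ≤ edgeWeight (a, v) + lexWeight K := by
      rw [← hW]
      refine add_le_add_right ?_ _
      by_contra hc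
      exact (add_lt_add_of_lt_of_le (not_le.1 hc) l2).ne (by rw [hval, add_comm])
    have hcard := card_eq_of_lexWeight_eq ((e.trans (le_antisymm l1 l3)))
    rw [Finset.card_insert_of_notMem (notMem_of_notMem_rights h1.notMem_rights _)] at hcard
    omega
  by_cases haN : a ∈ lefts N
  · obtain ⟨M₁, M₂, h1, h2, hval, hex⟩ := hN.1.exchange h0' subset_rfl subset_rfl haS haN ha0
    refine ⟨M₁, M₂, h1, h2, hex.notMem ha0, sum_eq_of_val_add_eq _ hval, ?_⟩
    have hpos := Finset.card_pos.2 ⟨a, haN⟩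
    rw [← h1.2.card_lefts, ← hN.1.2.card_lefts]
    rcases hex with ⟨b, hb, hbN, e1, e2, e3, e4⟩ | ⟨c, hc, hcM, e1, e2, e3, e4⟩
    · right
      rw [e1, Finset.card_erase_of_mem haN]
      omega
    · left
      rw [e1, Finset.card_insert_of_notMem fun h => hcM (Finset.mem_of_mem_erase h),
        Finset.card_erase_of_mem haN]
      omega
  · exact ⟨N, _, hN.1, h0', haN, rfl, Or.inl rfl⟩

/-- Whether a bidder on `v` only is matched depends on its edge weight and on the values of the
market with and without `v`. -/
theorem matched_of_lt (hM : Opt S Set.univ M) (hN : Opt S {v}ᶜ N) (hu : u.BidsOnly v x)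
    (huS : u ∉ S) (h : lexWeight M < edgeWeight (u, v) + lexWeight N)
    {K : Finset (Bidder ι × ι)} (hK : Opt (insert u S) Set.univ K) : u ∈ lefts K := by
  by_contra hc
  have h1 := hM.2 _ (hK.1.of_insert hc)
  have h2 := hK.2 _ (hN.1.insert_bidsOnly hu huS)
  rw [lexWeight_insert_edge hN.1] at h2
  exact absurd (h2.trans h1) (not_le.2 h)

theorem Feasible.le_of_mem (hN : Opt S {v}ᶜ N) (hu : u.BidsOnly v x)
    {K : Finset (Bidder ι × ι)} (hK : Feasible (insert u S) Set.univ K) (huK : u ∈ lefts K) :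
    lexWeight K ≤ edgeWeight (u, v) + lexWeight N := by
  have huv := mem_of_bidsOnly hu hK huK
  rw [← lexWeight_erase huv]
  exact add_le_add_right
    (hN.2 _ ((hK.erase huv).mono (Finset.erase_insert_subset u S) subset_rfl)) _

theorem notMatched_of_lt (hM : Opt S Set.univ M) (hN : Opt S {v}ᶜ N) (hu : u.BidsOnly v x)
    (h : edgeWeight (u, v) + lexWeight N < lexWeight M)
    {K : Finset (Bidder ι × ι)} (hK : Opt (insert u S) Set.univ K) : u ∉ lefts K := by
  intro hc
  exact absurd ((hK.2 M (hM.1.mono (Finset.subset_insert u S) subset_rfl)).trans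
    (Feasible.le_of_mem hN hu hK.1 hc)) (not_le.2 h)

theorem opt_of_eq (hM : Opt S Set.univ M) (hN : Opt S {v}ᶜ N) (hu : u.BidsOnly v x)
    (huS : u ∉ S) (h : lexWeight M = edgeWeight (u, v) + lexWeight N) :
    Opt (insert u S) Set.univ M ∧ Opt (insert u S) Set.univ (insert (u, v) N) := by
  have key : Opt (insert u S) Set.univ M := by
    refine ⟨hM.1.mono (Finset.subset_insert u S) subset_rfl, fun K hK => ?_⟩
    by_cases hc : u ∈ lefts K
    · rw [h]
      exact Feasible.le_of_mem hN hu hK hc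
    · exact hM.2 _ (hK.of_insert hc)
  refine ⟨key, key.of_le (hN.1.insert_bidsOnly hu huS) ?_⟩
  rw [lexWeight_insert_edge hN.1, h]

theorem _root_.UAP.Fresh.notMem {A : UAP ι} (h : A.Fresh u) : u ∉ A.bidders := fun hc => h u hc rfl

/-- The value that the market gains from `v`, as a pair of a real and a possibly infinite real,
compares with offers in the same way. -/
theorem exists_pair_compare {b : ℝ} (a c : ℝ) (hb : b = 0 ∨ b = 1) :
    ∃ p : ℝ ×ₗ WithBot ℝ, ∀ x z : ℝ,
      (p < toLex (x, (z : WithBot ℝ)) ↔ toLex (a, toLex (b, c)) < toLex (x, toLex ((1 : ℝ), z))) ∧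
      (toLex (x, (z : WithBot ℝ)) < p ↔ toLex (x, toLex ((1 : ℝ), z)) < toLex (a, toLex (b, c))) ∧
      (toLex (x, (z : WithBot ℝ)) = p ↔
        toLex (x, toLex ((1 : ℝ), z)) = toLex (a, toLex (b, c))) := by
  rcases hb with rfl | rfl
  -- When `v` brings no additional edge, a tie in the offer is decided by the cardinality entry, `1
  -- > 0`, whatever the priority.
  · refine ⟨toLex (a, ⊥), fun x z => ⟨?_, ?_, ?_⟩⟩
    · simp [Prod.Lex.toLex_lt_toLex]
    · simp [Prod.Lex.toLex_lt_toLex]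
    · simp
  · refine ⟨toLex (a, (c : WithBot ℝ)), fun x z => ⟨?_, ?_, ?_⟩⟩
    · simp [Prod.Lex.toLex_lt_toLex]
    · simp [Prod.Lex.toLex_lt_toLex]
    · simp

/-- Matching a bidder that bids only on `v` trades what the market gains from `v` for the weight of
the new edge. By `card_sub_of_opt` the cardinality entry of this gain can be taken in `{0, 1}`,
which lets a pair encode the comparison. -/
theorem exists_isThreshold [Finite ι] (A : UAP ι) (v : ι) : ∃ p, A.IsThreshold v p := by
  obtain ⟨M, hM⟩ := exists_opt A.bidders (Set.univ : Set ι)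
  obtain ⟨N, hN⟩ := exists_opt A.bidders ({v}ᶜ : Set ι)
  obtain ⟨a, b, c, habc, hb⟩ : ∃ a b c : ℝ,
      lexWeight M = toLex (a, toLex (b, c)) + lexWeight N ∧
        (b = 0 ∨ b = 1) := by
    rcases card_sub_of_opt hM hN with h | h
    · refine ⟨0, 0, 0, ?_, by simp⟩
      rw [h]
      exact (zero_add _).symm
    · refine ⟨UAP.matchingWeight M - UAP.matchingWeight N, (M.card : ℝ) - N.card,
        ∑ e ∈ M, e.1.priority - ∑ e ∈ N, e.1.priority, ?_, ?_⟩
      · rw [lexWeight_eq, lexWeight_eq, ← toLex_add, Prod.mk_add_mk, ← toLex_add, Prod.mk_add_mk]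
        simp
      · rcases h with h | h <;> simp [h]
  obtain ⟨p, hp⟩ := exists_pair_compare a c hb
  refine ⟨p, fun u hu x hux => ?_⟩
  have huA := hu.notMem
  have hadd : (A.add u hu).bidders = insert u A.bidders := rfl
  simp only [isGreedyMWM_iff, hadd, matched_eq_lefts]
  obtain ⟨h1, h2, h3⟩ := hp x u.priority
  rw [h1, h2, h3, ← edgeWeight_bidsOnly hux]
  refine ⟨fun h K hK => ?_, fun h K hK => ?_, fun h => ?_⟩
  · refine matched_of_lt hM hN hux huA ?_ hK
    rw [habc]
    exact add_lt_add_left h _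
  · refine notMatched_of_lt hM hN hux ?_ hK
    rw [habc]
    exact add_lt_add_left h _
  · rw [← h] at habc
    obtain ⟨k1, k2⟩ := opt_of_eq hM hN hux huA habc
    refine ⟨⟨_, k2, ?_⟩, ⟨_, k1, fun h => huA (hM.1.mem h)⟩⟩
    rw [lefts_insert]
    exact Finset.mem_insert_self _ _

theorem exists_between_pair {p q : ℝ ×ₗ WithBot ℝ} (h : p < q) : ∃ x z : ℝ,
    p < toLex (x, (z : WithBot ℝ)) ∧ toLex (x, (z : WithBot ℝ)) ≤ q := by
  obtain ⟨⟨a, b⟩, rfl⟩ := toLex.surjective p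
  obtain ⟨⟨c, d⟩, rfl⟩ := toLex.surjective q
  rcases Prod.Lex.toLex_lt_toLex.1 h with h | ⟨h, h'⟩
  · obtain ⟨x, h1, h2⟩ := exists_between h
    exact ⟨x, 0, Prod.Lex.toLex_lt_toLex.2 (Or.inl h1),
      (Prod.Lex.toLex_lt_toLex.2 (Or.inl h2)).le⟩
  · simp only at h h'
    subst h
    induction d using WithBot.recBotCoe with
    | bot => exact absurd h' not_lt_bot
    | coe d => exact ⟨a, d, Prod.Lex.toLex_lt_toLex.2 (Or.inr ⟨rfl, h'⟩), le_rfl⟩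

/-- For two thresholds `p < q`, a bidder with an offer in `(p, q]` would be matched in every greedy
MWM by `p`, yet missed by some greedy MWM by `q`. -/
theorem isThreshold_unique [Finite ι] {A : UAP ι} {p q : ℝ ×ₗ WithBot ℝ}
    (hp : A.IsThreshold v p) (hq : A.IsThreshold v q) : p = q := by
  by_contra hne
  wlog h : p < q generalizing p q
  · exact this hq hp (Ne.symm hne) (lt_of_le_of_ne (not_lt.1 h) (Ne.symm hne))
  obtain ⟨x, z, h1, h2⟩ := exists_between_pair h
  obtain ⟨u, hu, rfl, hid⟩ := exists_bidsOnly A.bidders v x z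
  have all := (hp u hid x hu).1 h1
  rcases h2.lt_or_eq with h2 | h2
  · obtain ⟨K, hK⟩ := exists_opt (A.add u hid).bidders (Set.univ : Set ι)
    have hK' := isGreedyMWM_iff.2 hK
    exact (hq u hid x hu).2.1 h2 K hK' (all K hK')
  · obtain ⟨-, K, hK, hn⟩ := (hq u hid x hu).2.2 h2
    exact hn (all K hK)

theorem isThreshold_threshold [Finite ι] (A : UAP ι) (v : ι) :
    A.IsThreshold v (A.threshold v) :=
  Classical.epsilon_spec (exists_isThreshold A v)

/-- Offers at or above the threshold can be matched. -/
theorem threshold_le_iff [Finite ι] {A : UAP ι} (hu : u.BidsOnly v x) (hf : A.Fresh u) :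
    A.threshold v ≤ toLex (x, (u.priority : WithBot ℝ)) ↔
      CanMatch (insert u A.bidders) Set.univ u := by
  have hadd : (A.add u hf).bidders = insert u A.bidders := rfl
  obtain ⟨h1, h2, h3⟩ := isThreshold_threshold A v u hf x hu
  simp only [isGreedyMWM_iff, hadd, matched_eq_lefts] at h1 h2 h3
  constructor
  · intro h
    rcases h.lt_or_eq with h | h
    · obtain ⟨K, hK⟩ := exists_opt (insert u A.bidders) (Set.univ : Set ι)
      exact ⟨K, hK, h1 h K hK⟩
    · exact (h3 h.symm).1
  · rintro ⟨K, hK, huK⟩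
    by_contra hc
    exact h2 (not_le.1 hc) K hK huK

end UnitDemand

/-! ### Stuck sets of bidders -/

namespace UnitDemand

open Matching

variable {ι : Type*} [DecidableEq ι]

/-- `lt` is a strict order that is total on the bidders in `X` of any given priority and does not
relate bidders of distinct priorities. -/
structure IsChainOrder (X : Finset (Bidder ι)) (lt : Bidder ι → Bidder ι → Prop) : Prop where
  irrefl : ∀ a, ¬ lt a a
  trans : ∀ a b c, lt a b → lt b c → lt a c
  priority_eq : ∀ a b, lt a b → a.priority = b.priority
  total : ∀ a ∈ X, ∀ b ∈ X, a.priority = b.priority → a ≠ b → lt a b ∨ lt b a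

/-- `S` is an initial part of `X`, and a bidder of `X` is outside `S` only if a bidder with the same
priority can be matched. -/
def Stuck (X : Finset (Bidder ι)) (lt : Bidder ι → Bidder ι → Prop) (P : Set ι)
    (S : Finset (Bidder ι)) : Prop :=
  S ⊆ X ∧ (∀ a ∈ X, ∀ b ∈ S, lt a b → a ∈ S) ∧
    ∀ b ∈ X, b ∉ S → ∃ w ∈ S, w.priority = b.priority ∧ CanMatch S P w

/-- `S` is the least stuck set. -/
def LeastStuck (X : Finset (Bidder ι)) (lt : Bidder ι → Bidder ι → Prop) (P : Set ι)
    (S : Finset (Bidder ι)) : Prop :=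
  Stuck X lt P S ∧ ∀ S', Stuck X lt P S' → S ⊆ S'

variable {X X' S S' A U : Finset (Bidder ι)} {lt lt' : Bidder ι → Bidder ι → Prop} {P P' : Set ι}
  {M N : Finset (Bidder ι × ι)} {a b u w y : Bidder ι} {v : ι} {x : ℝ}

theorem IsChainOrder.mono (h : IsChainOrder X lt) (hX : X' ⊆ X) : IsChainOrder X' lt :=
  ⟨h.irrefl, h.trans, h.priority_eq, fun a ha b hb => h.total a (hX ha) b (hX hb)⟩

theorem LeastStuck.unique (h : LeastStuck X lt P S) (h' : LeastStuck X lt P S') : S = S' :=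
  (h.2 S' h'.1).antisymm (h'.2 S h.1)

theorem Stuck.mono_items [Finite ι] (h : Stuck X lt P S) (hP : P ⊆ P') : Stuck X lt P' S :=
  ⟨h.1, h.2.1, fun b hb hbS => by
    obtain ⟨w, hw, hp, hc⟩ := h.2.2 b hb hbS
    exact ⟨w, hw, hp, hc.mono hw subset_rfl hP⟩⟩

theorem Stuck.exists_inter [Finite ι] (h : Stuck X lt P S) (hb : b ∈ X)
    (hbS : b ∉ S ∩ S') (hsub : ∀ c ∈ S, c.priority = b.priority → c ∈ S') :
    ∃ w ∈ S ∩ S', w.priority = b.priority ∧ CanMatch (S ∩ S') P w := by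
  obtain ⟨w, hw, hp, hc⟩ := h.2.2 b hb fun hbS' =>
    hbS (Finset.mem_inter.2 ⟨hbS', hsub b hbS' rfl⟩)
  have hw' := Finset.mem_inter.2 ⟨hw, hsub w hw hp⟩
  exact ⟨w, hw', hp, hc.mono hw' Finset.inter_subset_left subset_rfl⟩

/-- The bidders of one priority in `S` and in `S'` are initial parts of one chain, so one part
contains the other. The witness from the smaller part lies in the intersection and remains matchable
there by `CanMatch.mono`. -/
theorem Stuck.inter [Finite ι] (hX : IsChainOrder X lt) (h : Stuck X lt P S)
    (h' : Stuck X lt P S') : Stuck X lt P (S ∩ S') := by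
  refine ⟨Finset.inter_subset_left.trans h.1, fun a ha b hb hab => ?_, fun b hb hbS => ?_⟩
  · obtain ⟨h1, h2⟩ := Finset.mem_inter.1 hb
    exact Finset.mem_inter.2 ⟨h.2.1 a ha b h1 hab, h'.2.1 a ha b h2 hab⟩
  · by_cases hsub : ∀ c ∈ S, c.priority = b.priority → c ∈ S'
    · exact h.exists_inter hb hbS hsub
    · push Not at hsub
      obtain ⟨c, hc, hp, hcS'⟩ := hsub
      rw [Finset.inter_comm] at hbS ⊢
      refine h'.exists_inter hb hbS fun d hd hpd => ?_
      by_contra hdS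
      rcases hX.total c (h.1 hc) d (h'.1 hd) (hp.trans hpd.symm) (fun e => hdS (e ▸ hc)) with
        hlt | hlt
      · exact hcS' (h'.2.1 c (h.1 hc) d hd hlt)
      · exact hdS (h.2.1 d (h'.1 hd) c hc hlt)

theorem exists_leastStuck [Finite ι] (hX : IsChainOrder X lt) (P : Set ι) :
    ∃ S, LeastStuck X lt P S := by
  classical
  have hne : (X.powerset.filter (Stuck X lt P)).Nonempty :=
    ⟨X, Finset.mem_filter.2 ⟨Finset.mem_powerset_self X, subset_rfl, fun a ha _ _ _ => ha,
      fun b hb hbX => absurd hb hbX⟩⟩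
  obtain ⟨S, hS, hmin⟩ := Finset.exists_min_image _ Finset.card hne
  have hS' := (Finset.mem_filter.1 hS).2
  refine ⟨S, hS', fun T hT => ?_⟩
  have hi := hS'.inter hX hT
  have hc := hmin _ (Finset.mem_filter.2 ⟨Finset.mem_powerset.2 hi.1, hi⟩)
  have := Finset.eq_of_subset_of_card_le Finset.inter_subset_left hc
  exact Finset.inter_eq_left.1 this

/-- In the least stuck set, only the last bidder of a priority can be matched. -/
theorem LeastStuck.not_canMatch [Finite ι] (hX : IsChainOrder X lt) (h : LeastStuck X lt P S)
    (ha : a ∈ S) (hb : b ∈ S) (hab : lt a b) : ¬ CanMatch S P a := by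
  classical
  intro hc
  have hsub : S.filter (fun c => ¬ lt a c) ⊆ S := Finset.filter_subset _ _
  have haT : a ∈ S.filter (fun c => ¬ lt a c) := Finset.mem_filter.2 ⟨ha, hX.irrefl a⟩
  -- Cutting the chain right after a matchable `a` leaves a stuck set: `a` is the witness for the
  -- bidders cut off.
  have hstuck : Stuck X lt P (S.filter fun c => ¬ lt a c) := by
    refine ⟨hsub.trans h.1.1, fun c hc d hd hcd => ?_, fun c hc hcS => ?_⟩
    · obtain ⟨hd1, hd2⟩ := Finset.mem_filter.1 hd
      exact Finset.mem_filter.2 ⟨h.1.2.1 c hc d hd1 hcd, fun hac => hd2 (hX.trans _ _ _ hac hcd)⟩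
    · by_cases hp : a.priority = c.priority
      · exact ⟨a, haT, hp, CanMatch.mono ‹_› haT hsub subset_rfl⟩
      · have hcS' : c ∉ S := fun hcS' =>
          hcS (Finset.mem_filter.2 ⟨hcS', fun hac => hp (hX.priority_eq _ _ hac)⟩)
        obtain ⟨w, hw, hpw, hcw⟩ := h.1.2.2 c hc hcS'
        have hwT : w ∈ S.filter (fun c => ¬ lt a c) :=
          Finset.mem_filter.2 ⟨hw, fun haw => hp ((hX.priority_eq _ _ haw).trans hpw)⟩
        exact ⟨w, hwT, hpw, hcw.mono hwT hsub subset_rfl⟩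
  exact (Finset.mem_filter.1 (h.2 _ hstuck hb)).2 hab

/-- In the least stuck set, an optimal matching matches at most one bidder per priority. -/
theorem LeastStuck.eq_of_mem_lefts [Finite ι] (hX : IsChainOrder X lt) (h : LeastStuck X lt P S)
    (hM : Opt S P M) (ha : a ∈ lefts M) (hb : b ∈ lefts M) (hab : a.priority = b.priority) :
    a = b := by
  by_contra hne
  have haS := hM.1.mem ha
  have hbS := hM.1.mem hb
  rcases hX.total a (h.1.1 haS) b (h.1.1 hbS) hab hne with hlt | hlt
  · exact h.not_canMatch hX haS hbS hlt ⟨M, hM, ha⟩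
  · exact h.not_canMatch hX hbS haS hlt ⟨M, hM, hb⟩

/-! ### Adding a bidder on one item -/

theorem Opt.erase (hM : Opt S Set.univ M) (huv : (u, v) ∈ M) :
    Opt (S.erase u) {v}ᶜ (M.erase (u, v)) := by
  refine ⟨hM.1.erase huv, fun K hK => ?_⟩
  have hf : Feasible S Set.univ (insert (u, v) K) :=
    Feasible.insert_edge (hK.mono (Finset.erase_subset _ _) (Set.subset_univ _)) (hM.1.1 _ huv).1
      (fun h => by simpa using hK.mem h) (Set.mem_univ _) hK.notMem_rights (hM.1.1 _ huv).2.2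
  have hle := hM.2 _ hf
  rwa [lexWeight_insert_edge hK, ← lexWeight_erase huv, add_le_add_iff_left] at hle

/-- If some optimum uses `u`, then adding `(u, v)` to any optimum of the market without `v` is
optimal as well. Otherwise `u` is irrelevant and only the item `v` has been added. -/
theorem CanMatch.insert_bidsOnly [Finite ι] (h : CanMatch S {v}ᶜ w) (hu : u.BidsOnly v x)
    (huS : u ∉ S) : CanMatch (insert u S) Set.univ w := by
  obtain ⟨K, hK⟩ := exists_opt (insert u S) (Set.univ : Set ι)
  by_cases huK : u ∈ lefts K
  · obtain ⟨N, hN, hwN⟩ := h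
    refine ⟨insert (u, v) N, hK.of_le (hN.1.insert_bidsOnly hu huS) ?_, ?_⟩
    · rw [lexWeight_insert_edge hN.1]
      exact Feasible.le_of_mem hN hu hK.1 huK
    · rw [lefts_insert]
      exact Finset.mem_insert_of_mem hwN
  · obtain ⟨M, hM, hwM⟩ := h.mono h.mem subset_rfl (Set.subset_univ _)
    exact ⟨M, hK.of_le (hM.1.mono (Finset.subset_insert u S) subset_rfl)
      (hM.2 K (hK.1.of_insert huK)), hwM⟩

/-- If `u` bids on `v` only and always wins after it is appended to `X`, the other bidders that are
revealed do not depend on `u`. -/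
theorem LeastStuck.eq_insert [Finite ι] (huX : u ∉ X) (hlt : ∀ a ∈ X, ∀ b ∈ X, lt' a b ↔ lt a b)
    (hlt_u : ∀ a ∈ X, a.priority = u.priority → lt' a u) (hlt_u' : ∀ a ∈ X, ¬ lt' u a)
    (hpr : ∀ a ∈ X, lt' a u → a.priority = u.priority)
    (hu : u.BidsOnly v x) (hA : LeastStuck (insert u X) lt' Set.univ A)
    (hwin : ∀ M, Opt A Set.univ M → u ∈ lefts M) (hU : LeastStuck X lt {v}ᶜ U) :
    A = insert u U := by
  have huA : u ∈ A := by
    obtain ⟨M, hM⟩ := exists_opt A (Set.univ : Set ι)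
    exact hM.1.mem (hwin M hM)
  have huU : u ∉ U := fun h => huX (hU.1.1 h)
  have ne_u : ∀ a ∈ X, a ≠ u := fun a ha e => huX (e ▸ ha)
  apply Finset.Subset.antisymm
  -- If a bidder of this priority were missing from `U`, its witness would also excuse the absence
  -- of `u`; then `U` would be stuck and contain `A`, although `u ∈ A`.
  · have full : ∀ s ∈ X, s.priority = u.priority → s ∈ U := by
      intro s hs hp
      by_contra hsU
      obtain ⟨w, hw, hpw, hc⟩ := hU.1.2.2 s hs hsU
      have hU1 := hU.1.mono_items (Set.subset_univ _)
      refine huU (hA.2 U ⟨hU.1.1.trans (Finset.subset_insert _ _), ?_, ?_⟩ huA)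
      · intro a ha b hb hab
        rcases Finset.mem_insert.1 ha with rfl | ha
        · exact absurd hab (hlt_u' b (hU.1.1 hb))
        · exact hU.1.2.1 a ha b hb ((hlt a ha b (hU.1.1 hb)).1 hab)
      · intro b hb hbU
        rcases Finset.mem_insert.1 hb with rfl | hb
        · exact ⟨w, hw, hpw.trans hp, hc.mono hw subset_rfl (Set.subset_univ _)⟩
        · exact hU1.2.2 b hb hbU
    refine hA.2 _ ⟨Finset.insert_subset_insert _ hU.1.1, ?_, ?_⟩
    · intro a ha b hb hab
      rcases Finset.mem_insert.1 ha with rfl | ha'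
      · exact Finset.mem_insert_self _ _
      refine Finset.mem_insert_of_mem ?_
      rcases Finset.mem_insert.1 hb with rfl | hb
      · exact full a ha' (hpr a ha' hab)
      · exact hU.1.2.1 a ha' b hb ((hlt a ha' b (hU.1.1 hb)).1 hab)
    · intro b hb hbU
      rcases Finset.mem_insert.1 hb with rfl | hb
      · exact absurd (Finset.mem_insert_self _ _) hbU
      obtain ⟨w, hw, hpw, hc⟩ := hU.1.2.2 b hb fun h => hbU (Finset.mem_insert_of_mem h)
      exact ⟨w, Finset.mem_insert_of_mem hw, hpw, hc.insert_bidsOnly hu huU⟩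
  · refine Finset.insert_subset huA ((hU.2 (A.erase u) ⟨?_, ?_, ?_⟩).trans
      (Finset.erase_subset _ _))
    · intro a ha
      exact (Finset.mem_insert.1 (hA.1.1 (Finset.mem_of_mem_erase ha))).resolve_left
        (Finset.ne_of_mem_erase ha)
    · intro a ha b hb hab
      have hbA := Finset.mem_of_mem_erase hb
      have hbX := (Finset.mem_insert.1 (hA.1.1 hbA)).resolve_left (Finset.ne_of_mem_erase hb)
      exact Finset.mem_erase.2 ⟨ne_u a ha,
        hA.1.2.1 a (Finset.mem_insert_of_mem ha) b hbA ((hlt a ha b hbX).2 hab)⟩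
    · intro b hb hbU
      have hbA : b ∉ A := fun h => hbU (Finset.mem_erase.2 ⟨ne_u b hb, h⟩)
      obtain ⟨w, hw, hpw, M, hM, hwM⟩ := hA.1.2.2 b (Finset.mem_insert_of_mem hb) hbA
      -- If `u` were the witness, `b` would precede `u` and already lie in `A`.
      have hwu : w ≠ u := by
        rintro rfl
        exact hbA (hA.1.2.1 b (Finset.mem_insert_of_mem hb) w huA (hlt_u b hb hpw.symm))
      have huv := mem_of_bidsOnly hu hM.1 (hwin M hM)
      refine ⟨w, Finset.mem_erase.2 ⟨hwu, hw⟩, hpw, _, hM.erase huv, ?_⟩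
      rw [hM.1.2.lefts_erase huv]
      exact Finset.mem_erase.2 ⟨hwu, hwM⟩

/-! ### Comparing a multibidder with the thresholds of the other multibidders -/

theorem edgeWeight_eq (hu : u.BidsOnly v (y.weight v)) (hp : u.priority = y.priority) :
    edgeWeight (u, v) = edgeWeight (y, v) := by
  rw [edgeWeight_bidsOnly hu, edgeWeight, hp]

/-- The bidder matched to `v` could be replaced by its restriction to `v` in the market of the other
priorities. -/
theorem LeastStuck.canMatch_of_matched [Finite ι] (hX : IsChainOrder X lt)
    (hA : LeastStuck X lt Set.univ A) (hM : Opt A Set.univ M) (hyv : (y, v) ∈ M)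
    (hS : LeastStuck (X.filter fun b => b.priority ≠ y.priority) lt {v}ᶜ S)
    (hu : u.BidsOnly v (y.weight v)) (hp : u.priority = y.priority) :
    CanMatch (insert u S) Set.univ u := by
  set U := A.filter fun b => b.priority ≠ y.priority with hUdef
  have hy : y ∈ lefts M := mem_lefts.2 ⟨v, hyv⟩
  have hyA := hM.1.mem hy
  have hUA : U ⊆ A := Finset.filter_subset _ _
  have hyU : y ∉ U := by simp [hUdef]
  have huU : u ∉ U := by simp [hUdef, hp]
  have hM' : Opt (insert y U) Set.univ M := by
    refine hM.restrict (Finset.insert_subset hyA hUA) fun w hw => ?_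
    by_cases hwp : w.priority = y.priority
    · rw [hA.eq_of_mem_lefts hX hM hw hy hwp]
      exact Finset.mem_insert_self _ _
    · exact Finset.mem_insert_of_mem (Finset.mem_filter.2 ⟨hM.1.mem hw, hwp⟩)
  have hN : Opt U {v}ᶜ (M.erase (y, v)) := by
    have := hM'.erase hyv
    rwa [Finset.erase_insert hyU] at this
  have hSU : S ⊆ U := by
    refine hS.2 U ⟨Finset.filter_subset_filter _ hA.1.1, fun a ha b hb hab => ?_,
      fun b hb hbU => ?_⟩
    · obtain ⟨haX, hap⟩ := Finset.mem_filter.1 ha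
      exact Finset.mem_filter.2 ⟨hA.1.2.1 a haX b (hUA hb) hab, hap⟩
    · obtain ⟨hbX, hbp⟩ := Finset.mem_filter.1 hb
      obtain ⟨w, hw, hwp, K, hK, hwK⟩ := hA.1.2.2 b hbX fun h =>
        hbU (Finset.mem_filter.2 ⟨h, hbp⟩)
      -- All optima match the same priorities, so the witness can be taken in `M`, where it survives
      -- the removal of `(y, v)`.
      obtain ⟨w', hw', hwp'⟩ := hK.exists_priority_eq hM hwK
      have hb' : w'.priority = b.priority := hwp'.trans hwp
      refine ⟨w', Finset.mem_filter.2 ⟨hM.1.mem hw', hb' ▸ hbp⟩, hb', _, hN, ?_⟩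
      rw [hM.1.2.lefts_erase hyv]
      refine Finset.mem_erase.2 ⟨?_, hw'⟩
      rintro rfl
      exact hbp hb'.symm
  refine CanMatch.mono ⟨insert (u, v) (M.erase (y, v)), ⟨hN.1.insert_bidsOnly hu huU,
    fun K hK => ?_⟩, ?_⟩ (Finset.mem_insert_self u S) (Finset.insert_subset_insert u hSU) subset_rfl
  · rw [lexWeight_insert_edge hN.1]
    by_cases huK : u ∈ lefts K
    · exact Feasible.le_of_mem hN hu hK huK
    · rw [edgeWeight_eq hu hp, lexWeight_erase hyv]
      exact hM.2 K ((hK.of_insert huK).mono hUA subset_rfl)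
  · rw [lefts_insert]
    exact Finset.mem_insert_self _ _

theorem Feasible.exists_replace (hu : u.BidsOnly v (y.weight v)) (hp : u.priority = y.priority)
    (hv : v ∈ y.items) (hy : y ∉ S) (hM : Feasible (insert u S) Set.univ M) (huM : u ∈ lefts M) :
    ∃ M', Feasible (insert y S) Set.univ M' ∧ lexWeight M' = lexWeight M := by
  have huv := mem_of_bidsOnly hu hM huM
  have h := (hM.erase huv).mono (Finset.erase_insert_subset u S) subset_rfl
  refine ⟨insert (y, v) (M.erase (u, v)),
    Feasible.insert_edge (h.mono (Finset.subset_insert _ _) (Set.subset_univ _))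
      (Finset.mem_insert_self _ _) (fun hc => hy (h.mem hc)) (Set.mem_univ _) h.notMem_rights hv, ?_⟩
  rw [lexWeight_insert_edge h, ← edgeWeight_eq hu hp, lexWeight_erase huv]

/-- A bidder that is revealed before another bidder of its priority cannot, when restricted to one of
its items, be matched in the market of the other priorities.  If it could, the optimal matchings of
the least stuck set with that restricted bidder would be larger than those of a bigger stuck set. -/
theorem LeastStuck.not_canMatch_of_lt [Finite ι] (hX : IsChainOrder X lt)
    (hA : LeastStuck X lt Set.univ A) {y' : Bidder ι} (hyA : y ∈ A) (hyA' : y' ∈ A)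
    (hyy' : lt y y') (hv : v ∈ y.items)
    (hS : LeastStuck (X.filter fun b => b.priority ≠ y.priority) lt {v}ᶜ S)
    (hu : u.BidsOnly v (y.weight v)) (hp : u.priority = y.priority) :
    ¬ CanMatch (insert u S) Set.univ u := by
  classical
  intro hcan
  set X' := X.filter fun b => b.priority ≠ y.priority with hX'def
  -- The chain of `y` is cut off after `y`.
  set X₁ := X.filter fun b => ¬ lt y b with hX₁def
  have hX'X : X' ⊆ X := Finset.filter_subset _ _
  have hX₁X : X₁ ⊆ X := Finset.filter_subset _ _
  have huX' : u ∉ X' := by simp [hX'def, hp]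
  have huS : u ∉ S := fun h => huX' (hS.1.1 h)
  obtain ⟨A₁, hA₁⟩ := exists_leastStuck (hX.mono hX₁X) (Set.univ : Set ι)
  -- Otherwise `A₁` would be stuck in all of `X` and contain `y'`, which was cut off.
  have hno : ∀ w, w.priority = y.priority → ¬ CanMatch A₁ Set.univ w := by
    intro w hwp hcw
    have : Stuck X lt Set.univ A₁ := by
      refine ⟨hA₁.1.1.trans hX₁X, fun a ha b hb hab => ?_, fun b hb hbA => ?_⟩
      · refine hA₁.1.2.1 a (Finset.mem_filter.2 ⟨ha, fun hya => ?_⟩) b hb hab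
        exact (Finset.mem_filter.1 (hA₁.1.1 hb)).2 (hX.trans _ _ _ hya hab)
      · by_cases hyb : lt y b
        · exact ⟨w, hcw.mem, hwp.trans (hX.priority_eq _ _ hyb), hcw⟩
        · exact hA₁.1.2.2 b (Finset.mem_filter.2 ⟨hb, hyb⟩) hbA
    exact (Finset.mem_filter.1 (hA₁.1.1 (hA.2 A₁ this hyA'))).2 hyy'
  have hyA₁ : y ∈ A₁ := by
    by_contra hc
    obtain ⟨w, hw, hwp, hcw⟩ :=
      hA₁.1.2.2 y (Finset.mem_filter.2 ⟨hA.1.1 hyA, hX.irrefl y⟩) hc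
    exact hno w hwp hcw
  set U := A₁.filter fun b => b.priority ≠ y.priority with hUdef
  have hUA : U ⊆ A₁ := Finset.filter_subset _ _
  have hyU : y ∉ U := by simp [hUdef]
  -- Any matching that uses `u` can use `y ∈ A₁` instead, so `u` cannot improve on an optimum of
  -- `A₁`.
  have hopt : ∀ N, Opt A₁ Set.univ N → lefts N ⊆ U ∧ Opt (insert u U) Set.univ N := by
    intro N hN
    have hl : lefts N ⊆ U := fun w hw =>
      Finset.mem_filter.2 ⟨hN.1.mem hw, fun hwp => hno w hwp ⟨N, hN, hw⟩⟩
    refine ⟨hl, (hN.1.restrict hl).mono (Finset.subset_insert _ _) subset_rfl, fun K hK => ?_⟩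
    by_cases huK : u ∈ lefts K
    · obtain ⟨K', hK', he⟩ := Feasible.exists_replace hu hp hv hyU hK huK
      rw [← he]
      exact hN.2 K' (hK'.mono (Finset.insert_subset hyA₁ hUA) subset_rfl)
    · exact hN.2 K ((hK.of_insert huK).mono hUA subset_rfl)
  have hXu : IsChainOrder (insert u X') lt := by
    refine ⟨hX.irrefl, hX.trans, hX.priority_eq, fun a ha b hb hab hne => ?_⟩
    rcases Finset.mem_insert.1 ha with rfl | ha' <;> rcases Finset.mem_insert.1 hb with rfl | hb'
    · exact absurd rfl hne
    · exact absurd (hab.symm.trans hp) (Finset.mem_filter.1 hb').2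
    · exact absurd (hab.trans hp) (Finset.mem_filter.1 ha').2
    · exact hX.total a (hX'X ha') b (hX'X hb') hab hne
  -- `C` lies below both `insert u S`, where `u` is assumed matchable, and `insert u U`, where the
  -- optima of `A₁` remain optimal.
  obtain ⟨C, hC⟩ := exists_leastStuck hXu (Set.univ : Set ι)
  have closed : ∀ T : Finset (Bidder ι), (∀ a ∈ X', ∀ b ∈ T, lt a b → a ∈ T) →
      ∀ a ∈ insert u X', ∀ b ∈ insert u T, lt a b → a ∈ insert u T := by
    intro T hT a ha b hb hab
    rcases Finset.mem_insert.1 ha with rfl | ha'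
    · exact Finset.mem_insert_self _ _
    rcases Finset.mem_insert.1 hb with rfl | hb
    · exact absurd ((hX.priority_eq _ _ hab).trans hp) (Finset.mem_filter.1 ha').2
    · exact Finset.mem_insert_of_mem (hT a ha' b hb hab)
  have hCS : C ⊆ insert u S := by
    refine hC.2 _ ⟨Finset.insert_subset_insert _ hS.1.1, closed S hS.1.2.1, fun b hb hbS => ?_⟩
    rcases Finset.mem_insert.1 hb with rfl | hb
    · exact absurd (Finset.mem_insert_self _ _) hbS
    obtain ⟨w, hw, hwp, hcw⟩ := hS.1.2.2 b hb fun h => hbS (Finset.mem_insert_of_mem h)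
    exact ⟨w, Finset.mem_insert_of_mem hw, hwp, hcw.insert_bidsOnly hu huS⟩
  have mem_X₁ : ∀ b ∈ X', b ∈ X₁ := fun b hb => by
    obtain ⟨hbX, hbp⟩ := Finset.mem_filter.1 hb
    exact Finset.mem_filter.2 ⟨hbX, fun h => hbp (hX.priority_eq _ _ h).symm⟩
  have hCU : C ⊆ insert u U := by
    refine hC.2 _ ⟨Finset.insert_subset_insert _ fun a ha => ?_, closed U fun a ha b hb hab => ?_,
      fun b hb hbU => ?_⟩
    · obtain ⟨ha1, ha2⟩ := Finset.mem_filter.1 ha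
      exact Finset.mem_filter.2 ⟨hX₁X (hA₁.1.1 ha1), ha2⟩
    · exact Finset.mem_filter.2
        ⟨hA₁.1.2.1 a (mem_X₁ a ha) b (hUA hb) hab, (Finset.mem_filter.1 ha).2⟩
    · rcases Finset.mem_insert.1 hb with rfl | hb
      · exact absurd (Finset.mem_insert_self _ _) hbU
      have hbp := (Finset.mem_filter.1 hb).2
      obtain ⟨w, hw, hwp, N, hN, hwN⟩ := hA₁.1.2.2 b (mem_X₁ b hb) fun h =>
        hbU (Finset.mem_insert_of_mem (Finset.mem_filter.2 ⟨h, hbp⟩))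
      exact ⟨w, Finset.mem_insert_of_mem ((hopt N hN).1 hwN), hwp, N, (hopt N hN).2, hwN⟩
  -- No other bidder of this market has the priority of `u`, so nothing can excuse its absence.
  have huC : u ∈ C := by
    by_contra hc
    obtain ⟨w, hw, hwp, -⟩ := hC.1.2.2 u (Finset.mem_insert_self _ _) hc
    rcases Finset.mem_insert.1 (hC.1.1 hw) with rfl | h
    · exact hc hw
    · exact (Finset.mem_filter.1 h).2 (hwp.trans hp)
  obtain ⟨M, hM, huM⟩ := hcan.mono huC hCS subset_rfl
  obtain ⟨N, hN⟩ := exists_opt A₁ (Set.univ : Set ι)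
  obtain ⟨hNU, hN'⟩ := hopt N hN
  have hle := hM.card_le hN' hCU
  -- A bidder matched by `N` is either in `C` and matchable there, or outside `C` because a bidder
  -- of its priority is matchable.
  have hsub : (lefts N).image Bidder.priority ⊆ (lefts M).image Bidder.priority := by
    intro z hz
    obtain ⟨w, hw, rfl⟩ := Finset.mem_image.1 hz
    have hwU := hNU hw
    rw [Finset.mem_image]
    by_cases hwC : w ∈ C
    · obtain ⟨K, hK, hwK⟩ := CanMatch.mono ⟨N, hN', hw⟩ hwC hCU subset_rfl
      exact hK.exists_priority_eq hM hwK
    · have hwX' : w ∈ X' := by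
        obtain ⟨ha1, ha2⟩ := Finset.mem_filter.1 hwU
        exact Finset.mem_filter.2 ⟨hX₁X (hA₁.1.1 ha1), ha2⟩
      obtain ⟨w', hw', hwp', K, hK, hwK⟩ :=
        hC.1.2.2 w (Finset.mem_insert_of_mem hwX') hwC
      obtain ⟨w'', h1, h2⟩ := hK.exists_priority_eq hM hwK
      exact ⟨w'', h1, h2.trans hwp'⟩
  -- `M` also matches the priority of `u`. As `N` matches each priority at most once, `M` has more
  -- edges than `N`, contradicting `hle`.
  have hss : (lefts N).image Bidder.priority ⊂ (lefts M).image Bidder.priority := by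
    refine (Finset.ssubset_iff_of_subset hsub).2
      ⟨u.priority, Finset.mem_image_of_mem _ huM, fun hc => ?_⟩
    obtain ⟨w, hw, hwp⟩ := Finset.mem_image.1 hc
    exact (Finset.mem_filter.1 (hNU hw)).2 (hwp.trans hp)
  have h1 := Finset.card_lt_card hss
  rw [Finset.card_image_of_injOn fun a ha b hb hab =>
    hA₁.eq_of_mem_lefts (hX.mono hX₁X) hN ha hb hab] at h1
  have h2 := (Finset.card_image_le : ((lefts M).image Bidder.priority).card ≤ _)
  rw [hN.1.2.card_lefts] at h1
  rw [hM.1.2.card_lefts] at h2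
  omega

end UnitDemand

/-! ### The algorithm returns the least stuck set -/

namespace UnitDemand

open Matching

variable {ι : Type*} [DecidableEq ι] {B : IUAP ι} {A : UAP ι} {t t' : Multibidder ι}
  {S : Finset (Bidder ι)} {P : Set ι} {a b u w : Bidder ι} {v : ι} {x : ℝ}

/-- `a` comes before `b` in the sequence of some multibidder. -/
def Before (B : IUAP ι) (a b : Bidder ι) : Prop :=
  ∃ t ∈ B.multibidders, ∃ i j : ℕ, i < j ∧ t.seq[i]? = some a ∧ t.seq[j]? = some b

theorem mem_bidders_iff : u ∈ B.bidders ↔ ∃ t ∈ B.multibidders, ∃ i : ℕ, t.seq[i]? = some u := by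
  simp [IUAP.bidders, Multibidder.bidders, List.mem_iff_getElem?]

theorem priority_of_getElem? {i : ℕ} (h : t.seq[i]? = some u) : u.priority = t.priority :=
  t.priority_eq u (List.mem_of_getElem? h)

theorem eq_of_priority_eq (ht : t ∈ B.multibidders) (ht' : t' ∈ B.multibidders)
    (h : t.priority = t'.priority) : t = t' := by
  by_contra hne
  exact B.priority_ne t ht t' ht' hne h

theorem index_unique {i j : ℕ} (hi : t.seq[i]? = some u) (hj : t.seq[j]? = some u) : i = j := by
  have hnd : t.seq.Nodup := List.Nodup.of_map _ t.nodup_id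
  exact (List.getElem?_inj (List.getElem?_eq_some_iff.1 hi).1 hnd).1 (hi.trans hj.symm)

theorem isChainOrder_before (B : IUAP ι) : IsChainOrder B.bidders (Before B) := by
  refine ⟨?_, ?_, ?_, ?_⟩
  · rintro a ⟨t, ht, i, j, hij, hi, hj⟩
    exact hij.ne (index_unique hi hj)
  · rintro a b c ⟨t, ht, i, j, hij, hi, hj⟩ ⟨t', ht', j', k, hjk, hj', hk⟩
    obtain rfl := eq_of_priority_eq ht ht'
      ((priority_of_getElem? hj).symm.trans (priority_of_getElem? hj'))
    obtain rfl := index_unique hj hj'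
    exact ⟨t, ht, i, k, hij.trans hjk, hi, hk⟩
  · rintro a b ⟨t, ht, i, j, hij, hi, hj⟩
    rw [priority_of_getElem? hi, priority_of_getElem? hj]
  · intro a ha b hb hab hne
    obtain ⟨t, ht, i, hi⟩ := mem_bidders_iff.1 ha
    obtain ⟨t', ht', j, hj⟩ := mem_bidders_iff.1 hb
    obtain rfl := eq_of_priority_eq ht ht'
      ((priority_of_getElem? hi).symm.trans (hab.trans (priority_of_getElem? hj)))
    rcases lt_trichotomy i j with h | rfl | h
    · exact Or.inl ⟨t, ht, i, j, h, hi, hj⟩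
    · exact absurd (Option.some.inj (hi.symm.trans hj)) hne
    · exact Or.inr ⟨t, ht, j, i, h, hj, hi⟩

theorem Prefix.mem_of_before (h : IUAP.Prefix A B) (hb : b ∈ A.bidders) (hab : Before B a b) :
    a ∈ A.bidders := by
  obtain ⟨t, ht, i, j, hij, hi, hj⟩ := hab
  obtain ⟨n, hn⟩ := h.2 t ht
  have hbt : b ∈ A.bidders ∩ t.bidders :=
    Finset.mem_inter.2 ⟨hb, List.mem_toFinset.2 (List.mem_of_getElem? hj)⟩
  rw [hn, List.mem_toFinset] at hbt
  obtain ⟨m, hm⟩ := List.mem_iff_getElem?.1 hbt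
  rw [List.getElem?_take] at hm
  split_ifs at hm with hmn
  obtain rfl := index_unique hj hm
  have hat : a ∈ (t.seq.take n).toFinset := by
    rw [List.mem_toFinset, List.mem_iff_getElem?]
    exact ⟨i, by rw [List.getElem?_take, if_pos (hij.trans hmn), hi]⟩
  rw [← hn] at hat
  exact (Finset.mem_inter.1 hat).1

theorem greedyZero_iff [Finite ι] {z : ℝ} :
    A.GreedyZero z ↔ ∀ w, CanMatch A.bidders Set.univ w → w.priority ≠ z := by
  simp only [UAP.GreedyZero, isGreedyMWM_iff, matched_eq_lefts, CanMatch]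
  exact ⟨fun h w ⟨M, hM, hw⟩ => h M hM w hw, fun h M hM w hw => h w ⟨M, hM, hw⟩⟩

theorem prefix_of_reachable (h : Relation.ReflTransGen B.Step UAP.empty A) : IUAP.Prefix A B := by
  induction h with
  | refl => exact ⟨by simp [UAP.empty], fun t _ => ⟨0, by simp [UAP.empty]⟩⟩
  | tail _ hs ih =>
    obtain ⟨u, hu, hr, rfl⟩ := hs
    exact (ih.ready hr).2.2

/-- Only bidders of a given stuck set are revealed. -/
theorem subset_of_reachable [Finite ι] (hS : Stuck B.bidders (Before B) Set.univ S)
    (h : Relation.ReflTransGen B.Step UAP.empty A) : A.bidders ⊆ S := by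
  induction h with
  | refl => simp [UAP.empty]
  | @tail A A' hA hs ih =>
    obtain ⟨u, hu, hr, rfl⟩ := hs
    obtain ⟨huB, hf, hpre⟩ := (prefix_of_reachable hA).ready hr
    refine Finset.insert_subset ?_ ih
    by_contra huS
    -- The witness `w` precedes `u`, so it is already revealed, and it is matchable in the smaller
    -- set `A`; hence `u` was not ready.
    obtain ⟨w, hw, hwp, hc⟩ := hS.2.2 u huB huS
    have hne : w ≠ u := fun e => huS (e ▸ hw)
    have hwu : Before B w u := by
      rcases (isChainOrder_before B).total w (hS.1 hw) u huB hwp hne with h | h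
      · exact h
      · exact absurd (hS.2.1 u huB w hw h) huS
    have hwA : w ∈ A.bidders :=
      (Finset.mem_insert.1 (Prefix.mem_of_before hpre (Finset.mem_insert_self _ _) hwu)).resolve_left
        hne
    exact greedyZero_iff.1 hr.1 w (hc.mono hwA ih subset_rfl) hwp

/-- At termination, the next unrevealed bidder of the multibidder of `b` is not ready, so some
bidder of that priority is matchable. -/
theorem stuck_of_returns [Finite ι] (h : B.Returns A) :
    Stuck B.bidders (Before B) Set.univ A.bidders := by
  have hpre := prefix_of_reachable h.1
  refine ⟨hpre.1, fun a _ b hb hab => Prefix.mem_of_before hpre hb hab, fun b hb hbA => ?_⟩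
  obtain ⟨t, ht, j, hj⟩ := mem_bidders_iff.1 hb
  obtain ⟨n, hn⟩ := hpre.2 t ht
  have hnj : n ≤ j := by
    by_contra hc
    have : b ∈ (t.seq.take n).toFinset := by
      rw [List.mem_toFinset, List.mem_iff_getElem?]
      exact ⟨j, by rw [List.getElem?_take, if_pos (not_le.1 hc), hj]⟩
    rw [← hn] at this
    exact hbA (Finset.mem_inter.1 this).1
  have hlen : n < t.seq.length := hnj.trans_lt (List.getElem?_eq_some_iff.1 hj).1
  have hnd : t.seq.Nodup := List.Nodup.of_map _ t.nodup_id
  have hcard : (A.bidders ∩ t.bidders).card = n := by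
    rw [hn, List.toFinset_card_of_nodup (hnd.sublist (List.take_sublist _ _)), List.length_take]
    omega
  have hget : t.seq[n]? = some t.seq[n] := List.getElem?_eq_getElem hlen
  have hnr := h.2 t.seq[n]
  have hz : ¬ A.GreedyZero (t.seq[n]).priority := fun hz => hnr ⟨hz, t, ht, by rw [hcard, hget]⟩
  rw [greedyZero_iff] at hz
  push Not at hz
  obtain ⟨w, hc, hwp⟩ := hz
  exact ⟨w, hc.mem, by rw [hwp, priority_of_getElem? hget, priority_of_getElem? hj], hc⟩

theorem leastStuck_of_returns [Finite ι] (h : B.Returns A) :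
    LeastStuck B.bidders (Before B) Set.univ A.bidders :=
  ⟨stuck_of_returns h, fun _ hS => subset_of_reachable hS h.1⟩

theorem leastStuck_uap [Finite ι] (B : IUAP ι) :
    LeastStuck B.bidders (Before B) Set.univ B.uap.bidders :=
  leastStuck_of_returns B.exists_returns.choose_spec

theorem returns_iff [Finite ι] : B.Returns A ↔ A = B.uap := by
  refine ⟨fun h => UAP.ext ((leastStuck_of_returns h).unique (leastStuck_uap B)), ?_⟩
  rintro rfl
  exact B.exists_returns.choose_spec

/-! ### Removing a multibidder and adding a bidder -/

/-- An order that is already total within each priority admits no proper extension there. -/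
theorem IsChainOrder.iff_of_imp {X X' : Finset (Bidder ι)} {lt lt' : Bidder ι → Bidder ι → Prop}
    (h : IsChainOrder X lt) (h' : IsChainOrder X' lt') (imp : ∀ a b, lt a b → lt' a b)
    (a : Bidder ι) (ha : a ∈ X) (b : Bidder ι) (hb : b ∈ X) : lt' a b ↔ lt a b := by
  refine ⟨fun hab => ?_, imp a b⟩
  rcases h.total a ha b hb (h'.priority_eq _ _ hab) (fun e => h'.irrefl a (e ▸ hab)) with hl | hl
  · exact hl
  · exact absurd (h'.trans _ _ _ hab (imp _ _ hl)) (h'.irrefl a)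

theorem LeastStuck.congr {X : Finset (Bidder ι)} {lt lt' : Bidder ι → Bidder ι → Prop}
    (h : LeastStuck X lt P S) (hlt : ∀ a ∈ X, ∀ b ∈ X, lt' a b ↔ lt a b) :
    LeastStuck X lt' P S := by
  have key : ∀ T, Stuck X lt' P T ↔ Stuck X lt P T := fun T =>
    and_congr_right fun hT => and_congr_left fun _ =>
      forall₄_congr fun a ha b hb => by rw [hlt a ha b (hT hb)]
  exact ⟨(key S).2 h.1, fun T hT => h.2 T ((key T).1 hT)⟩

theorem bidders_erase (ht : t ∈ B.multibidders) :
    (B.erase t).bidders = B.bidders.filter fun b => b.priority ≠ t.priority := by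
  ext u
  rw [Finset.mem_filter, mem_bidders_iff, mem_bidders_iff]
  constructor
  · rintro ⟨s, hs, i, hi⟩
    obtain ⟨hst, hsB⟩ := Finset.mem_erase.1 hs
    refine ⟨⟨s, hsB, i, hi⟩, ?_⟩
    rw [priority_of_getElem? hi]
    exact B.priority_ne s hsB t ht hst
  · rintro ⟨⟨s, hs, i, hi⟩, hp⟩
    refine ⟨s, Finset.mem_erase.2 ⟨?_, hs⟩, i, hi⟩
    rintro rfl
    exact hp (priority_of_getElem? hi)

theorem before_of_before_erase (h : Before (B.erase t) a b) : Before B a b := by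
  obtain ⟨s, hs, h⟩ := h
  exact ⟨s, Finset.mem_of_mem_erase hs, h⟩

theorem exists_multibidders_add (hu : B.Fresh u) :
    (∃ t ∈ B.multibidders, ∃ s : Multibidder ι, t.priority = u.priority ∧ s.seq = t.seq ++ [u] ∧
      (B.add u hu).multibidders = insert s (B.multibidders.erase t)) ∨
    (∀ t ∈ B.multibidders, t.priority ≠ u.priority) ∧ ∃ s : Multibidder ι, s.seq = [u] ∧
      (B.add u hu).multibidders = insert s B.multibidders := by
  by_cases h : ∃ t ∈ B.multibidders, t.priority = u.priority
  · left
    refine ⟨h.choose, h.choose_spec.1,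
      h.choose.append u h.choose_spec.2 (hu.of_mem h.choose_spec.1), h.choose_spec.2, rfl, ?_⟩
    rw [IUAP.add, dif_pos h]
    rfl
  · right
    refine ⟨fun t ht e => h ⟨t, ht, e⟩, Multibidder.single u, rfl, ?_⟩
    rw [IUAP.add, dif_neg h]
    rfl

theorem bidders_add (hu : B.Fresh u) : (B.add u hu).bidders = insert u B.bidders := by
  have hm : ∀ (t : Multibidder ι) w, w ∈ t.bidders ↔ w ∈ t.seq := fun t w => List.mem_toFinset
  ext w
  simp only [IUAP.bidders, Finset.mem_insert, Finset.mem_biUnion, hm]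
  rcases exists_multibidders_add hu with ⟨t, ht, s, hp, hs, he⟩ | ⟨-, s, hs, he⟩
  · rw [he]
    constructor
    · rintro ⟨r, hr, hw⟩
      rcases Finset.mem_insert.1 hr with rfl | hr
      · rw [hs, List.mem_append, List.mem_singleton] at hw
        rcases hw with hw | hw
        · exact Or.inr ⟨t, ht, hw⟩
        · exact Or.inl hw
      · exact Or.inr ⟨r, Finset.mem_of_mem_erase hr, hw⟩
    · rintro (rfl | ⟨r, hr, hw⟩)
      · exact ⟨s, Finset.mem_insert_self _ _, by simp [hs]⟩
      · by_cases hrt : r = t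
        · subst hrt
          exact ⟨s, Finset.mem_insert_self _ _, by simp [hs, hw]⟩
        · exact ⟨r, Finset.mem_insert_of_mem (Finset.mem_erase.2 ⟨hrt, hr⟩), hw⟩
  · rw [he]
    simp [hs]

theorem before_add (hu : B.Fresh u) (h : Before B a b) : Before (B.add u hu) a b := by
  obtain ⟨r, hr, i, j, hij, hi, hj⟩ := h
  rcases exists_multibidders_add hu with ⟨t, ht, s, hp, hs, he⟩ | ⟨-, s, hs, he⟩
  · by_cases hrt : r = t
    · subst hrt
      refine ⟨s, he ▸ Finset.mem_insert_self _ _, i, j, hij, ?_, ?_⟩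
      · rw [hs, List.getElem?_append_left (List.getElem?_eq_some_iff.1 hi).1, hi]
      · rw [hs, List.getElem?_append_left (List.getElem?_eq_some_iff.1 hj).1, hj]
    · exact ⟨r, he ▸ Finset.mem_insert_of_mem (Finset.mem_erase.2 ⟨hrt, hr⟩), i, j, hij, hi, hj⟩
  · exact ⟨r, he ▸ Finset.mem_insert_of_mem hr, i, j, hij, hi, hj⟩

theorem before_add_self (hu : B.Fresh u) (ha : a ∈ B.bidders) (hp : a.priority = u.priority) :
    Before (B.add u hu) a u := by
  obtain ⟨r, hr, i, hi⟩ := mem_bidders_iff.1 ha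
  have hrp := (priority_of_getElem? hi).symm.trans hp
  rcases exists_multibidders_add hu with ⟨t, ht, s, htp, hs, he⟩ | ⟨hno, -⟩
  · obtain rfl := eq_of_priority_eq hr ht (hrp.trans htp.symm)
    have hlt := (List.getElem?_eq_some_iff.1 hi).1
    refine ⟨s, he ▸ Finset.mem_insert_self _ _, i, r.seq.length, hlt, ?_, ?_⟩
    · rw [hs, List.getElem?_append_left hlt, hi]
    · rw [hs]
      simp
  · exact absurd hrp (hno r hr)

/-! ### The UAP associated with an item -/

theorem isWinner_iff [Finite ι] :
    B.IsWinner u ↔ ∀ M, Opt B.uap.bidders Set.univ M → u ∈ lefts M := by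
  simp only [IUAP.IsWinner, isGreedyMWM_iff, matched_eq_lefts]

/-- In `B + u` the new bidder comes last in its priority, which is the situation of
`LeastStuck.eq_insert`. -/
theorem isUapAt_of_leastStuck [Finite ι] (hA : LeastStuck B.bidders (Before B) {v}ᶜ A.bidders) :
    B.IsUapAt v A := by
  refine ⟨hA.1.1, fun u hu x hux hwin => ?_⟩
  have huB : u ∉ B.bidders := fun h => hu u h rfl
  have hL := leastStuck_uap (B.add u hu)
  have hC := isChainOrder_before (B.add u hu)
  rw [bidders_add hu] at hL
  refine hL.eq_insert huB ((isChainOrder_before B).iff_of_imp hC fun a b => before_add hu)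
    (fun a ha hp => before_add_self hu ha hp) (fun a ha h => ?_) (fun a _ => hC.priority_eq a u)
    hux (isWinner_iff.1 hwin) hA
  exact hC.irrefl u (hC.trans _ _ _ h (before_add_self hu ha (hC.priority_eq _ _ h).symm))

/-- A bidder on `v` only with a sufficiently high offer and a new priority is a winner. -/
theorem exists_isWinner [Finite ι] (B : IUAP ι) (v : ι) :
    ∃ (u : Bidder ι) (hu : B.Fresh u) (x : ℝ), u.BidsOnly v x ∧ (B.add u hu).IsWinner u := by
  obtain ⟨z, hz⟩ := (B.bidders.image Bidder.priority).exists_notMem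
  obtain ⟨u, hux, rfl, hu⟩ :=
    -- The new priority forces `u` to be revealed. The offer is positive and exceeds every other
    -- offer on `v`, so giving `v` to an unmatched `u` would always increase the weight.
    exists_bidsOnly B.bidders v (1 + ∑ b ∈ B.bidders, |b.weight v|) z
  refine ⟨u, hu, _, hux, isWinner_iff.2 fun M hM => ?_⟩
  have hL := leastStuck_uap (B.add u hu)
  rw [bidders_add hu] at hL
  have hsum : 0 ≤ ∑ b ∈ B.bidders, |b.weight v| := Finset.sum_nonneg fun _ _ => abs_nonneg _
  have huA : u ∈ (B.add u hu).uap.bidders := by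
    by_contra hc
    obtain ⟨w, hw, hwp, -⟩ := hL.1.2.2 u (Finset.mem_insert_self _ _) hc
    rcases Finset.mem_insert.1 (hL.1.1 hw) with rfl | h
    · exact hc hw
    · exact hz (Finset.mem_image.2 ⟨w, h, hwp⟩)
  by_contra huM
  by_cases hv : v ∈ rights M
  · obtain ⟨a, ha⟩ := mem_rights.1 hv
    have haA := (hM.1.1 _ ha).1
    have haB : a ∈ B.bidders := (Finset.mem_insert.1 (hL.1.1 haA)).resolve_left
      fun e => huM (e ▸ mem_lefts.2 ⟨v, ha⟩)
    have hK := (hM.1.erase ha).mono (Finset.erase_subset _ _) subset_rfl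
    have hle := hM.2 _ (Feasible.insert_edge (hK.mono subset_rfl (Set.subset_univ _)) huA
      (fun h => huM (by
        rw [hM.1.2.lefts_erase ha] at h
        exact Finset.mem_of_mem_erase h)) (Set.mem_univ v) hK.notMem_rights hux.mem_items)
    rw [lexWeight_insert_edge hK, ← lexWeight_erase ha, add_le_add_iff_right] at hle
    refine absurd hle (not_le.2 ?_)
    rw [edgeWeight_bidsOnly hux, edgeWeight]
    refine Prod.Lex.toLex_lt_toLex.2 (Or.inl ?_)
    have h1 := Finset.single_le_sum (f := fun b : Bidder ι => |b.weight v|)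
      (fun _ _ => abs_nonneg _) haB
    have h2 := le_abs_self (a.weight v)
    simp only at h1 ⊢
    linarith
  · have hK := hM.1.compl hv
    have hle := hM.2 _ (Feasible.insert_edge hM.1 huA huM (Set.mem_univ v) hv hux.mem_items)
    rw [lexWeight_insert_edge hK] at hle
    refine absurd hle (not_le.2 (lt_add_of_pos_left _ ?_))
    rw [edgeWeight_bidsOnly hux]
    refine Prod.Lex.toLex_lt_toLex.2 (Or.inl ?_)
    change (0 : ℝ) < _
    linarith

theorem exists_uap_leastStuck [Finite ι] (B : IUAP ι) (v : ι) :
    ∃ A : UAP ι, LeastStuck B.bidders (Before B) {v}ᶜ A.bidders := by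
  obtain ⟨S, hS⟩ := exists_leastStuck (isChainOrder_before B) ({v}ᶜ : Set ι)
  exact ⟨⟨S, fun a ha b hb hne h => hne (B.eq_of_id_eq (hS.1.1 ha) (hS.1.1 hb) h)⟩, hS⟩

/-- A winner exists, so the defining property is not vacuous; both UAPs arise by deleting this
winner from the same set. -/
theorem isUapAt_unique [Finite ι] {A A' : UAP ι} (h : B.IsUapAt v A) (h' : B.IsUapAt v A') :
    A = A' := by
  obtain ⟨u, hu, x, hux, hwin⟩ := exists_isWinner B v
  have huA : u ∉ A.bidders := fun hc => hu u (h.1 hc) rfl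
  have huA' : u ∉ A'.bidders := fun hc => hu u (h'.1 hc) rfl
  have e := (h.2 u hu x hux hwin).symm.trans (h'.2 u hu x hux hwin)
  refine UAP.ext ?_
  have h1 : (insert u A.bidders).erase u = (insert u A'.bidders).erase u := by
    exact congrArg (fun s => Finset.erase s u) e
  rwa [Finset.erase_insert huA, Finset.erase_insert huA'] at h1

theorem leastStuck_uapAt [Finite ι] (B : IUAP ι) (v : ι) :
    LeastStuck B.bidders (Before B) {v}ᶜ (B.uapAt v).bidders := by
  obtain ⟨A, hA⟩ := exists_uap_leastStuck B v
  have h := isUapAt_of_leastStuck hA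
  rw [IUAP.uapAt, isUapAt_unique (Classical.epsilon_spec ⟨A, h⟩) h]
  exact hA

theorem leastStuck_uapAt_erase [Finite ι] (ht : t ∈ B.multibidders) (v : ι) :
    LeastStuck (B.bidders.filter fun b => b.priority ≠ t.priority) (Before B) {v}ᶜ
      ((B.erase t).uapAt v).bidders := by
  have h := (leastStuck_uapAt (B.erase t) v).congr
    ((isChainOrder_before (B.erase t)).iff_of_imp (isChainOrder_before B)
      fun a b => before_of_before_erase)
  rwa [bidders_erase ht] at h

end UnitDemand

/-! ### The main theorem -/

open UnitDemand Matching

theorem mainTheorem3 {ι : Type*} [Finite ι] (B : IUAP ι) (t : Multibidder ι)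
    (ht : t ∈ B.multibidders) (k : Fin t.seq.length) (v : ι)
    (hkv : ∃ M, B.uap.IsGreedyMWM M ∧ (t.seq.get k, v) ∈ M) :
    -- `uap(B)` does not depend on the execution, and the thresholds are well defined
    (∀ A, B.Returns A ↔ A = B.uap) ∧
    (∀ v' : ι, (∃! A, (B.erase t).IsUapAt v' A) ∧
      ∃! p, ((B.erase t).uapAt v').IsThreshold v' p) ∧
    -- the two inequalities
    (B.erase t).threshold v ≤ toLex ((t.seq.get k).weight v, (t.priority : WithBot ℝ)) ∧
    ∀ (k' : Fin t.seq.length) (v' : ι), k' < k → v' ∈ (t.seq.get k').items →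
      toLex ((t.seq.get k').weight v', (t.priority : WithBot ℝ)) < (B.erase t).threshold v' := by
  classical
  obtain ⟨M, hM, hkM⟩ := hkv
  have hM := isGreedyMWM_iff.1 hM
  have hX := isChainOrder_before B
  have hA := leastStuck_uap B
  have hprio : ∀ i : Fin t.seq.length, (t.seq.get i).priority = t.priority := fun i =>
    t.priority_eq _ (List.get_mem _ _)
  have hget : ∀ i : Fin t.seq.length, t.seq[i.1]? = some (t.seq.get i) := fun i => by simp
  have hfresh : ∀ (u : Bidder ι) (v' : ι), (∀ w ∈ B.bidders, w.id ≠ u.id) →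
      ((B.erase t).uapAt v').Fresh u := fun u v' hu w hw =>
    hu w (Finset.filter_subset _ _ ((leastStuck_uapAt_erase ht v').1.1 hw))
  have hk : t.seq.get k ∈ B.uap.bidders := (hM.1.1 _ hkM).1
  refine ⟨fun A => returns_iff, fun v' => ⟨?_, ?_⟩, ?_, fun k' v' hkk hv' => ?_⟩
  · obtain ⟨A, hA⟩ := exists_uap_leastStuck (B.erase t) v'
    exact ⟨A, isUapAt_of_leastStuck hA, fun A' h => isUapAt_unique h (isUapAt_of_leastStuck hA)⟩
  · exact ⟨_, isThreshold_threshold _ v', fun q hq =>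
      isThreshold_unique hq (isThreshold_threshold _ v')⟩
  -- `u` is the restriction of the matched bidder to `v`, under an unused ID; its offer is the pair
  -- to be compared with the threshold.
  · obtain ⟨u, hu, hp, hid⟩ :=
      exists_bidsOnly B.bidders v ((t.seq.get k).weight v) (t.seq.get k).priority
    have hS := leastStuck_uapAt_erase ht v
    rw [← hprio k] at hS
    have := (threshold_le_iff hu (hfresh u v hid)).2
      (hA.canMatch_of_matched hX hM hkM hS hu hp)
    rwa [hp, hprio k] at this
  · obtain ⟨u, hu, hp, hid⟩ :=
      exists_bidsOnly B.bidders v' ((t.seq.get k').weight v') (t.seq.get k').priority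
    have hS := leastStuck_uapAt_erase ht v'
    rw [← hprio k'] at hS
    have hlt : Before B (t.seq.get k') (t.seq.get k) := ⟨t, ht, k', k, hkk, hget k', hget k⟩
    -- The matched bidder is revealed, so its predecessors are revealed too.
    have hk' : t.seq.get k' ∈ B.uap.bidders :=
      hA.1.2.1 _ (mem_bidders_iff.2 ⟨t, ht, k', hget k'⟩) _ hk hlt
    have := (threshold_le_iff hu (hfresh u v' hid)).not.2
      (hA.not_canMatch_of_lt hX hk' hk hlt hv' hS hu hp)
    rw [hp, hprio k'] at this
    exact not_le.1 this
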